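/- Let $G$ be a finite, connected metric tree with at least one edge; that is, $G$ is a finite connected discrete graph without cycles, with vertex set $V$ and nonempty edge set $E$, together with a length $L(e)\in(0,\infty)$ for each edge $e$, where $e$ is identified with the interval $[0,L(e)]$, the endpoint $0$ corresponding to the vertex $o(e)$ and $L(e)$ to the vertex $t(e)$. Let $-\Delta_G$ be the standard Laplacian in $L^2(G)$, $(-\Delta_G f)_e=-f_e''$ on each edge $e$, whose domain consists of all $f\colon G\to\mathbb{C}$ with $f_e\in H^2(0,L(e))$ for each $e\in E$ which are continuous at the vertices and satisfy $$\sum_{t(e)=v} f_e'(L(e))-\sum_{o(e)=v} f_e'(0)=0\qquad\text{for every } v\in V,$$ and let $\lambda_1(G)\le\lambda_2(G)\le\dots$ be its eigenvalues, counted with multiplicities. Let $\operatorname{diam}(G)=\sup\{\operatorname{dist}(x,y): x,y\in G\}$, where $x,y$ range over all points of $G$ (not only the vertices) and $\operatorname{dist}$ is the path metric induced by the edge lengths. Then $$\lambda_{k+1}(G)\le\frac{k^2\pi^2}{\operatorname{diam}(G)^2}\qquad\text{for all integers } k\ge 0.$$ -/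

import Mathlib

open MeasureTheory

/-- A metric graph with vertex set `V` and edge set `E`; loops and parallel edges are allowed.
The edge `e` originates at `src e`, terminates at `tgt e`, and is identified with the interval
`[0, len e]`, where `0` corresponds to `src e` and `len e` to `tgt e`. -/
structure MetricGraph (V E : Type*) where
  src : E → V
  tgt : E → V
  len : E → ℝ
  len_pos : ∀ e, 0 < len e

namespace MetricGraph

variable {V E : Type*} (G : MetricGraph V E)

/-- The underlying discrete graph, with loops deleted and parallel edges merged. -/
def toSimpleGraph : SimpleGraph V :=
  SimpleGraph.fromEdgeSet (Set.range fun e => s(G.src e, G.tgt e))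

/-- `G` is a connected tree: it has no loops (cycles of length one), no parallel edges (cycles of
length two), and the underlying simple graph is connected and has no cycles. -/
def IsTree : Prop :=
  (∀ e, G.src e ≠ G.tgt e) ∧
  (Function.Injective fun e => s(G.src e, G.tgt e)) ∧
  G.toSimpleGraph.IsTree

/-- The disjoint union of the closed edges. The metric graph as a space arises from it by
identifying all the edge ends that lie at the same vertex, see `IsAt`. -/
abbrev EdgePoint : Type _ := Σ e : E, Set.Icc (0 : ℝ) (G.len e)

/-- The point `p` is an end of an edge, and that end is the vertex `v`. -/
def IsAt (p : G.EdgePoint) (v : V) : Prop :=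
  ((p.2 : ℝ) = 0 ∧ G.src p.1 = v) ∨ ((p.2 : ℝ) = G.len p.1 ∧ G.tgt p.1 = v)

/-- `G.HasPath p q ℓ`: there is a path of length `ℓ` from `p` to `q`, consisting of finitely many
segments of edges that are joined at common points or at vertices. -/
inductive HasPath : G.EdgePoint → G.EdgePoint → ℝ → Prop
  | segment (e : E) (x y : Set.Icc (0 : ℝ) (G.len e)) :
      HasPath ⟨e, x⟩ ⟨e, y⟩ |(x : ℝ) - (y : ℝ)|
  | glue (p q : G.EdgePoint) (v : V) : G.IsAt p v → G.IsAt q v → HasPath p q 0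
  | trans (p q r : G.EdgePoint) (a b : ℝ) : HasPath p q a → HasPath q r b → HasPath p r (a + b)

/-- The distance of two points: the infimum of the lengths of the paths that connect them. -/
noncomputable def dist (p q : G.EdgePoint) : ℝ := sInf {l : ℝ | G.HasPath p q l}

/-- The diameter of the metric graph. -/
noncomputable def diam : ℝ := sSup {d : ℝ | ∃ p q : G.EdgePoint, d = G.dist p q}

/-- `f`, restricted to `[0, L]`, is (the continuous representative of) a function in `H¹(0, L)` and
`g` is its derivative: `f` is a primitive of the square integrable function `g`. -/
def HasSobolevDeriv (L : ℝ) (f g : ℝ → ℂ) : Prop :=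
  MemLp g 2 (volume.restrict (Set.Icc 0 L)) ∧
    ∀ x ∈ Set.Icc 0 L, f x = f 0 + ∫ t in (0 : ℝ)..x, g t

variable {G} in
/-- The restriction of `f` to the edge `e`, as a function of the coordinate in `[0, len e]`
(extended by constants to the real line; only the values in `[0, len e]` are ever used). -/
noncomputable def onEdge (f : G.EdgePoint → ℂ) (e : E) : ℝ → ℂ :=
  Set.IccExtend (G.len_pos e).le fun x => f ⟨e, x⟩

/-- `f` belongs to the domain of the standard Laplacian `-Δ_G`, and `-Δ_G f = g`. That is: on every
edge `f` is in `H²` with first derivative `f'` and second derivative `-g`; `f` is continuous at the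
vertices; and at every vertex the sum of the normal derivatives of `f` is zero. Functions in the
domain are represented by their continuous representatives, `f'` likewise. -/
def IsLaplacian [Fintype E] [DecidableEq V] (f : G.EdgePoint → ℂ) (g : E → ℝ → ℂ) : Prop :=
  ∃ f' : E → ℝ → ℂ,
    (∀ e, HasSobolevDeriv (G.len e) (onEdge f e) (f' e)) ∧
    (∀ e, HasSobolevDeriv (G.len e) (f' e) (fun x => -g e x)) ∧
    (∀ (v : V) (p q : G.EdgePoint), G.IsAt p v → G.IsAt q v → f p = f q) ∧
    ∀ v : V, (∑ e : E, if G.tgt e = v then f' e (G.len e) else 0)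
      - (∑ e : E, if G.src e = v then f' e 0 else 0) = 0

/-- The span of all the eigenspaces `ker (-Δ_G - lam)` with `lam ≤ μ`. Its dimension is the number
of eigenvalues of `-Δ_G` in `(-∞, μ]`, counted with multiplicities. -/
noncomputable def spectralSpace [Fintype E] [DecidableEq V] (μ : ℝ) :
    Submodule ℂ (G.EdgePoint → ℂ) :=
  Submodule.span ℂ {f | ∃ lam : ℝ, lam ≤ μ ∧
    G.IsLaplacian f (fun e x => (lam : ℂ) * onEdge f e x)}

/-- The `k`-th eigenvalue (`k = 1, 2, …`) of the standard Laplacian `-Δ_G` in nondecreasing order,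
counted with multiplicities: the least `μ` such that at least `k` eigenvalues are `≤ μ`.
It is `⊤` if there are fewer than `k` eigenvalues. -/
noncomputable def eigenvalue [Fintype E] [DecidableEq V] (k : ℕ) : EReal :=
  sInf {x : EReal | ∃ μ : ℝ, x = (μ : EReal) ∧
    (k : Cardinal) ≤ Module.rank ℂ (G.spectralSpace μ)}

end MetricGraph

/-! The inequality is a min-max argument with trial functions living on a single path. A tree
contains paths whose length D exceeds any given number below the diameter
(`exists_isPath_lt_walkLen`). Along such a path take cos(jπt/D), j = 1, …, k, and continue these
functions by constants into the branches that hang off the path. Their derivatives vanish off the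
path, while the branches can only enlarge the L² norm. Hence ‖f'‖² ≤ (kπ/D)² ‖f‖² on the span, even
after a constant is added to f (`integral_norm_derivCosPoly_sq_le`). The constants contribute the
eigenvalue 0 as one further dimension, and D may tend to the diameter.

Min-max is applied to a bounded operator instead of the Laplacian. On a tree every g in L²(G) is the
derivative of a continuous function on G, unique up to a constant (`IsTree.exists_primitive`). Let A
g be the primitive orthogonal to 1. The operator A is compact, and A†A g = t g says ⟨φ, u⟩ = t ⟨φ',
u'⟩ for u = A g and all test functions φ; for t ≠ 0 this is the weak form of -u'' = t⁻¹ u with the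
vertex conditions (`IsCompat.isLaplacian`). Eigenvalues t ≥ μ⁻¹ of A†A therefore give Laplacian
eigenvalues ≤ μ. Their number is bounded below by the dimension of any space of derivatives g with
‖g‖² ≤ κ ‖A g‖², κ < μ (`le_rank_iSup_eigenspace_adjoint_comp`). The cosines enter through
`exists_unfolding`, which lays the path out on an interval. -/

/-! ### Counting eigenvalues of compact positive operators -/

namespace ContinuousLinearMap

open Module.End in
/-- The restriction of a compact positive operator to the orthogonal complement of all its
eigenspaces for eigenvalues `≥ τ` has numerical range in `[0, τ]`. -/
theorem re_inner_le_of_mem_orthogonal_iSup_eigenspace {H : Type*} [NormedAddCommGroup H]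
    [InnerProductSpace ℂ H] [CompleteSpace H] {T : H →L[ℂ] H} (hT : IsCompactOperator T)
    (hpos : T.IsPositive) {τ : ℝ} (hτ : 0 < τ) {u : H}
    (hu : u ∈ (⨆ t : {t : ℝ // τ ≤ t}, eigenspace (T : Module.End ℂ H) (t : ℂ))ᗮ) :
    RCLike.re (inner ℂ (T u) u) ≤ τ * ‖u‖ ^ 2 := by
  set M : Submodule ℂ H := ⨆ t : {t : ℝ // τ ≤ t}, eigenspace (T : Module.End ℂ H) (t : ℂ) with hM
  have hsymm : T.IsSymmetric := hpos.isSymmetric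
  have hinv : ∀ v ∈ Mᗮ, (T : H →ₗ[ℂ] H) v ∈ Mᗮ := by
    intro v hv
    rw [hM, ← Submodule.iInf_orthogonal] at hv ⊢
    exact LinearMap.iInf_invariant (T : H →ₗ[ℂ] H)
      (fun t => hsymm.invariant_orthogonalComplement_eigenspace _) v hv
  let S : Mᗮ →L[ℂ] Mᗮ := T.restrict hinv
  have hS : IsCompactOperator S := hT.restrict' hinv
  have hSsymm : S.IsSymmetric := hsymm.restrict_invariant hinv
  -- The norm of the compact self-adjoint `S` is its spectral radius. If it exceeded `τ`, it would
  -- be attained at an eigenvalue `≥ τ`, whose eigenvector would lie both in `M` and in its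
  -- orthogonal complement.
  have hnorm : ‖S‖ ≤ τ := by
    by_contra! hlt
    have : Nontrivial Mᗮ := by
      by_contra hn
      rw [not_nontrivial_iff_subsingleton] at hn
      have : ‖S‖ ≤ 0 := S.opNorm_le_bound le_rfl fun x => by simp [Subsingleton.elim x 0]
      linarith
    obtain ⟨z, hz, hzn⟩ := spectrum.exists_nnnorm_eq_spectralRadius S
    rw [S.spectralRadius_eq_nnnorm hSsymm.isSelfAdjoint, ENNReal.coe_inj] at hzn
    have hzn' : ‖z‖ = ‖S‖ := congrArg NNReal.toReal hzn
    have hz0 : z ≠ 0 := by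
      rintro rfl
      rw [norm_zero] at hzn'
      linarith
    have hev := (hS.hasEigenvalue_iff_mem_spectrum hz0).2 hz
    have hreal := hSsymm.conj_eigenvalue_eq_self hev
    rw [Complex.conj_eq_iff_real] at hreal
    obtain ⟨r, rfl⟩ := hreal
    have hr0 : 0 ≤ r := by
      refine eigenvalue_nonneg_of_nonneg (𝕜 := ℂ) hev fun x => ?_
      exact hpos.re_inner_nonneg_right (x : H)
    have hr : τ ≤ r := by
      rw [Complex.norm_real, Real.norm_of_nonneg hr0] at hzn'
      linarith
    obtain ⟨x, hx, hx0⟩ := hev.exists_hasEigenvector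
    rw [mem_eigenspace_iff] at hx
    have hxM : (x : H) ∈ M := by
      refine Submodule.mem_iSup_of_mem (p := fun t : {t : ℝ // τ ≤ t} =>
        eigenspace (T : Module.End ℂ H) (t : ℂ)) ⟨r, hr⟩ ?_
      rw [mem_eigenspace_iff]
      exact congrArg Subtype.val hx
    have := Submodule.inner_right_of_mem_orthogonal hxM x.2
    rw [inner_self_eq_zero] at this
    exact hx0 (Subtype.ext this)
  calc RCLike.re (inner ℂ (T u) u) ≤ ‖T u‖ * ‖u‖ := re_inner_le_norm _ _
    _ = ‖S ⟨u, hu⟩‖ * ‖u‖ := rfl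
    _ ≤ (‖S‖ * ‖u‖) * ‖u‖ := by gcongr; exact S.le_opNorm ⟨u, hu⟩
    _ ≤ (τ * ‖u‖) * ‖u‖ := by gcongr
    _ = τ * ‖u‖ ^ 2 := by ring

open Module.End in
/-- A variational lower bound for the number of eigenvalues `≥ μ⁻¹` of `A† A`, where `A` is
compact: it is at least the dimension of any space on which `‖g‖² ≤ κ ‖A g‖²` for some `κ < μ`. -/
theorem le_rank_iSup_eigenspace_adjoint_comp {H : Type*} [NormedAddCommGroup H]
    [InnerProductSpace ℂ H] [CompleteSpace H] {A : H →L[ℂ] H} (hA : IsCompactOperator A) {k : ℕ}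
    (g : (Fin k → ℂ) →ₗ[ℂ] H) (hg : Function.Injective g) {κ μ : ℝ} (hμ : 0 < μ) (hκ : κ < μ)
    (h : ∀ a, ‖g a‖ ^ 2 ≤ κ * ‖A (g a)‖ ^ 2) :
    (k : Cardinal) ≤ Module.rank ℂ ↥(⨆ t : {t : ℝ // μ⁻¹ ≤ t},
      eigenspace ((adjoint A ∘L A : H →L[ℂ] H) : Module.End ℂ H) (t : ℂ)) := by
  set T : H →L[ℂ] H := adjoint A ∘L A with hTdef
  set M : Submodule ℂ H := ⨆ t : {t : ℝ // μ⁻¹ ≤ t}, eigenspace (T : Module.End ℂ H) (t : ℂ)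
  by_contra! hlt
  have : FiniteDimensional ℂ M := by
    exact Module.rank_lt_aleph0_iff.1 (hlt.trans Cardinal.natCast_lt_aleph0)
  rw [← Module.finrank_eq_rank, Nat.cast_lt] at hlt
  -- If `M` has dimension below `k`, some nonzero trial vector is orthogonal to it. There `μ ‖A g‖²
  -- ≤ ‖g‖² ≤ κ ‖A g‖²`, against `κ < μ`.
  have hker := LinearMap.ker_ne_bot_of_finrank_lt
    (f := (M.orthogonalProjectionOnto : H →ₗ[ℂ] M) ∘ₗ g) (by simpa using hlt)
  obtain ⟨a, ha, ha0⟩ := Submodule.exists_mem_ne_zero_of_ne_bot hker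
  have hmem : g a ∈ Mᗮ := by
    rw [LinearMap.mem_ker] at ha
    exact Submodule.orthogonalProjectionOnto_eq_zero_iff.1 ha
  have hga : 0 < ‖g a‖ := by
    rw [norm_pos_iff]
    exact fun h0 => ha0 (hg (h0.trans (map_zero g).symm))
  have hT : IsCompactOperator T := hA.clm_comp (adjoint A)
  have hle := re_inner_le_of_mem_orthogonal_iSup_eigenspace hT
    (isPositive_adjoint_comp_self A) (inv_pos.2 hμ) hmem
  have hre : RCLike.re (inner ℂ (T (g a)) (g a)) = ‖A (g a)‖ ^ 2 := by
    rw [hTdef, comp_apply, adjoint_inner_left, inner_self_eq_norm_sq]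
  rw [hre] at hle
  have h1 := h a
  have h2 : μ * ‖A (g a)‖ ^ 2 ≤ ‖g a‖ ^ 2 := by
    rwa [inv_mul_eq_div, le_div_iff₀' hμ] at hle
  have h3 : 0 < ‖A (g a)‖ ^ 2 := by
    by_contra h0
    have : ‖A (g a)‖ ^ 2 = 0 := le_antisymm (not_lt.1 h0) (sq_nonneg _)
    rw [this] at h1
    nlinarith
  nlinarith

end ContinuousLinearMap

/-! ### Primitives of L² functions on an interval -/

/-- The space `L²(0, L)`. -/
abbrev IntervalL2 (L : ℝ) : Type := Lp ℂ 2 (volume.restrict (Set.Icc 0 L))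

namespace IntervalL2

variable {L : ℝ}

theorem measure_Ioc_ne_top (L a b : ℝ) : volume.restrict (Set.Icc 0 L) (Set.Ioc a b) ≠ ⊤ :=
  measure_ne_top _ _

/-- The pairing of `g` with the indicator of `(a, b]`. -/
theorem inner_indicator (g : IntervalL2 L) (a b : ℝ) :
    inner ℂ (indicatorConstLp 2 measurableSet_Ioc (measure_Ioc_ne_top L a b) (1 : ℂ)) g
      = ∫ t in Set.Ioc a b, g t ∂(volume.restrict (Set.Icc 0 L)) := by
  exact L2.inner_indicatorConstLp_one _ _ _

theorem integrable (g : IntervalL2 L) : Integrable g (volume.restrict (Set.Icc 0 L)) :=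
  (Lp.memLp g).integrable one_le_two

theorem intervalIntegrable (g : IntervalL2 L) {a b : ℝ} (ha : a ∈ Set.Icc 0 L)
    (hb : b ∈ Set.Icc 0 L) : IntervalIntegrable g volume a b := by
  have h : IntegrableOn g (Set.Icc 0 L) volume := g.integrable
  exact (h.mono_set (Set.uIcc_subset_Icc ha hb)).intervalIntegrable

theorem setIntegral_Ioc (g : IntervalL2 L) {a b : ℝ} (ha : 0 ≤ a) (hab : a ≤ b) (hb : b ≤ L) :
    ∫ t in Set.Ioc a b, g t ∂(volume.restrict (Set.Icc 0 L)) = ∫ t in a..b, g t := by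
  rw [intervalIntegral.integral_of_le hab, Measure.restrict_restrict measurableSet_Ioc]
  congr 2
  exact Set.inter_eq_left.2 fun t ht => ⟨ha.trans ht.1.le, ht.2.trans hb⟩

/-- Cauchy–Schwarz against an indicator function. This Hölder bound of exponent 1/2 is the source of
continuity, boundedness and equicontinuity of primitives. -/
theorem norm_integral_le (g : IntervalL2 L) {a b : ℝ} (ha : 0 ≤ a) (hab : a ≤ b) (hb : b ≤ L) :
    ‖∫ t in a..b, g t‖ ≤ √(b - a) * ‖g‖ := by
  rw [← setIntegral_Ioc g ha hab hb, ← inner_indicator]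
  refine (norm_inner_le_norm _ _).trans ?_
  gcongr
  rw [norm_indicatorConstLp (by norm_num) (by norm_num), norm_one, one_mul, Real.sqrt_eq_rpow,
    measureReal_restrict_apply measurableSet_Ioc]
  norm_num
  gcongr
  calc volume.real (Set.Ioc a b ∩ Set.Icc 0 L) ≤ volume.real (Set.Ioc a b) :=
        measureReal_mono Set.inter_subset_left (by simp)
    _ = b - a := by simp [hab]

theorem dist_integral_le (g : IntervalL2 L) {a b : ℝ} (ha : a ∈ Set.Icc 0 L)
    (hb : b ∈ Set.Icc 0 L) :
    dist (∫ t in (0 : ℝ)..a, g t) (∫ t in (0 : ℝ)..b, g t) ≤ √(dist a b) * ‖g‖ := by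
  wlog hab : b ≤ a generalizing a b
  · rw [dist_comm, dist_comm a b]
    exact this hb ha (le_of_not_ge hab)
  have h0 : (0 : ℝ) ∈ Set.Icc 0 L := ⟨le_rfl, ha.1.trans ha.2⟩
  rw [dist_eq_norm, intervalIntegral.integral_interval_sub_left (g.intervalIntegrable h0 ha)
    (g.intervalIntegrable h0 hb), Real.dist_eq, abs_of_nonneg (sub_nonneg.2 hab)]
  exact norm_integral_le g hb.1 hab ha.2

theorem continuous_integral (g : IntervalL2 L) :
    Continuous fun x : Set.Icc (0 : ℝ) L => ∫ t in (0 : ℝ)..x, g t := by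
  rw [continuous_iff_continuousAt]
  intro x
  rw [ContinuousAt, tendsto_iff_dist_tendsto_zero]
  refine squeeze_zero (fun _ => dist_nonneg) (fun y => dist_integral_le g y.2 x.2) ?_
  have : Filter.Tendsto (fun y : Set.Icc (0 : ℝ) L => √(dist (y : ℝ) x) * ‖g‖) (nhds x)
      (nhds (√(dist (x : ℝ) x) * ‖g‖)) :=
    Continuous.tendsto (by fun_prop) x
  simpa using this

theorem integral_eq_inner (g : IntervalL2 L) (x : Set.Icc (0 : ℝ) L) :
    ∫ t in (0 : ℝ)..x, g t = inner ℂ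
      (indicatorConstLp 2 measurableSet_Ioc (measure_Ioc_ne_top L 0 x) (1 : ℂ)) g := by
  rw [inner_indicator, setIntegral_Ioc g le_rfl x.2.1 x.2.2]

/-- The primitive `x ↦ ∫₀ˣ g` as an operator from `L²(0, L)` to the continuous functions. -/
noncomputable def primitive (L : ℝ) : IntervalL2 L →L[ℂ] C(Set.Icc (0 : ℝ) L, ℂ) :=
  LinearMap.mkContinuous
    { toFun := fun g => ⟨fun x => ∫ t in (0 : ℝ)..x, g t, g.continuous_integral⟩
      map_add' := fun g h => by
        ext x
        simp only [ContinuousMap.coe_mk, ContinuousMap.add_apply, integral_eq_inner,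
          inner_add_right]
      map_smul' := fun c g => by
        ext x
        simp only [ContinuousMap.coe_mk, ContinuousMap.smul_apply, integral_eq_inner,
          inner_smul_right, RingHom.id_apply, smul_eq_mul] }
    (√L) fun g => by
      refine (ContinuousMap.norm_le _ (by positivity)).2 fun x => ?_
      refine (norm_integral_le g le_rfl x.2.1 x.2.2).trans ?_
      gcongr
      linarith [x.2.2]

theorem primitive_apply (g : IntervalL2 L) (x : Set.Icc (0 : ℝ) L) :
    primitive L g x = ∫ t in (0 : ℝ)..x, g t := rfl

/-- Arzelà–Ascoli: the primitives of the unit ball are bounded by `√L` and share the modulus of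
continuity `√`. -/
theorem isCompactOperator_primitive (L : ℝ) : IsCompactOperator (primitive L) := by
  let Φ := BoundedContinuousFunction.mkOfCompact (α := Set.Icc (0 : ℝ) L) (β := ℂ)
  have hΦ : Isometry Φ := (ContinuousMap.isometryEquivBoundedOfCompact _ _).isometry
  have hK : IsCompact (closure (Φ '' (primitive L '' Metric.closedBall 0 1))) := by
    refine BoundedContinuousFunction.arzela_ascoli (Metric.closedBall 0 √L)
      (isCompact_closedBall _ _) _ ?_ ?_
    · rintro _ x ⟨_, ⟨g, hg, rfl⟩, rfl⟩
      rw [mem_closedBall_zero_iff] at hg ⊢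
      refine (norm_integral_le g le_rfl x.2.1 x.2.2).trans ?_
      calc √(x - 0) * ‖g‖ ≤ √L * 1 := by
            gcongr
            linarith [x.2.2]
        _ = √L := mul_one _
    · refine Metric.equicontinuous_of_continuity_modulus Real.sqrt ?_ _ ?_
      · simpa using Real.continuous_sqrt.tendsto 0
      · rintro x y ⟨_, ⟨_, ⟨g, hg, rfl⟩, rfl⟩⟩
        rw [mem_closedBall_zero_iff] at hg
        refine (dist_integral_le g x.2 y.2).trans ?_
        exact (mul_le_of_le_one_right (Real.sqrt_nonneg _) hg)
  refine ⟨Φ ⁻¹' closure (Φ '' (primitive L '' Metric.closedBall 0 1)), ?_, ?_⟩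
  · exact (ContinuousMap.isometryEquivBoundedOfCompact (Set.Icc (0 : ℝ) L)
      ℂ).toHomeomorph.isCompact_preimage.2 hK
  · refine Filter.mem_of_superset (Metric.closedBall_mem_nhds 0 one_pos) fun g hg => ?_
    exact subset_closure ⟨_, ⟨g, hg, rfl⟩, rfl⟩

theorem memLp_IccExtend (hL : 0 ≤ L) (f : C(Set.Icc (0 : ℝ) L, ℂ)) :
    MemLp (Set.IccExtend hL f) 2 (volume.restrict (Set.Icc 0 L)) :=
  MemLp.of_bound f.continuous.Icc_extend'.aestronglyMeasurable ‖f‖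
    (Filter.Eventually.of_forall fun _ => f.norm_coe_le_norm _)

/-- The class in `L²(0, L)` of a continuous function. -/
noncomputable def ofContinuous (hL : 0 ≤ L) : C(Set.Icc (0 : ℝ) L, ℂ) →L[ℂ] IntervalL2 L :=
  LinearMap.mkContinuous
    { toFun := fun f => (memLp_IccExtend hL f).toLp _
      map_add' := fun f g => by
        rw [← MemLp.toLp_add]
        rfl
      map_smul' := fun c f => by
        rw [RingHom.id_apply, ← MemLp.toLp_const_smul]
        rfl }
    (√L) fun f => by
      have := Lp.norm_le_of_ae_bound (f := (memLp_IccExtend hL f).toLp _) (norm_nonneg f) (by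
        filter_upwards [(memLp_IccExtend hL f).coeFn_toLp] with x hx
        rw [hx]
        exact f.norm_coe_le_norm _)
      refine this.trans (le_of_eq ?_)
      congr 1
      simp only [measureUnivNNReal, Measure.restrict_apply_univ, Real.volume_Icc, sub_zero,
        Real.sqrt_eq_rpow, ENNReal.toReal_ofNat, one_div, ENNReal.coe_toNNReal_eq_toReal,
        ENNReal.toReal_ofReal hL]

theorem coeFn_ofContinuous (hL : 0 ≤ L) (f : C(Set.Icc (0 : ℝ) L, ℂ)) :
    ofContinuous hL f =ᵐ[volume.restrict (Set.Icc 0 L)] Set.IccExtend hL f :=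
  (memLp_IccExtend hL f).coeFn_toLp

theorem primitive_congr_ae (g : IntervalL2 L) {f : ℝ → ℂ}
    (h : g =ᵐ[volume.restrict (Set.Icc 0 L)] f) (x : Set.Icc (0 : ℝ) L) :
    primitive L g x = ∫ t in (0 : ℝ)..x, f t := by
  rw [primitive_apply, intervalIntegral.integral_of_le x.2.1,
    intervalIntegral.integral_of_le x.2.1]
  refine integral_congr_ae (ae_restrict_of_ae_restrict_of_subset ?_ h)
  exact fun t ht => ⟨ht.1.le, ht.2.trans x.2.2⟩

theorem primitive_ofContinuous (hL : 0 ≤ L) (f : C(Set.Icc (0 : ℝ) L, ℂ))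
    (x : Set.Icc (0 : ℝ) L) :
    primitive L (ofContinuous hL f) x = ∫ t in (0 : ℝ)..x, Set.IccExtend hL f t :=
  primitive_congr_ae _ (coeFn_ofContinuous hL f) x

theorem inner_eq_integral {f g : IntervalL2 L} {u v : ℝ → ℂ} (hL : 0 ≤ L)
    (hf : f =ᵐ[volume.restrict (Set.Icc 0 L)] u) (hg : g =ᵐ[volume.restrict (Set.Icc 0 L)] v) :
    inner ℂ f g = ∫ t in (0 : ℝ)..L, starRingEnd ℂ (u t) * v t := by
  rw [L2.inner_def, intervalIntegral.integral_of_le hL, ← integral_Icc_eq_integral_Ioc]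
  refine integral_congr_ae ?_
  filter_upwards [hf, hg] with t h1 h2
  rw [h1, h2, RCLike.inner_apply, mul_comm]

theorem inner_ofContinuous (hL : 0 ≤ L) (f g : C(Set.Icc (0 : ℝ) L, ℂ)) :
    inner ℂ (ofContinuous hL f) (ofContinuous hL g)
      = ∫ t in (0 : ℝ)..L, starRingEnd ℂ (Set.IccExtend hL f t) * Set.IccExtend hL g t :=
  inner_eq_integral hL (coeFn_ofContinuous hL f) (coeFn_ofContinuous hL g)

theorem norm_ofContinuous_sq (hL : 0 ≤ L) (f : C(Set.Icc (0 : ℝ) L, ℂ)) :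
    ‖ofContinuous hL f‖ ^ 2 = ∫ t in (0 : ℝ)..L, ‖Set.IccExtend hL f t‖ ^ 2 := by
  have h : ((‖ofContinuous hL f‖ ^ 2 : ℝ) : ℂ) =
      ((∫ t in (0 : ℝ)..L, ‖Set.IccExtend hL f t‖ ^ 2 : ℝ) : ℂ) := by
    rw [← intervalIntegral.integral_ofReal]
    have := inner_self_eq_norm_sq_to_K (𝕜 := ℂ) (ofContinuous hL f)
    push_cast
    rw [inner_ofContinuous] at this
    refine this.symm.trans ?_
    refine intervalIntegral.integral_congr fun t _ => ?_
    simp [Complex.conj_mul']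
  exact_mod_cast h

theorem denseRange_ofContinuous (hL : 0 ≤ L) : DenseRange (ofContinuous hL) := by
  refine (BoundedContinuousFunction.toLp_denseRange (E := ℂ) (p := 2) (𝕜 := ℂ)
    (μ := volume.restrict (Set.Icc 0 L)) (by norm_num)).mono ?_
  rintro _ ⟨b, rfl⟩
  refine ⟨b.toContinuousMap.restrict (Set.Icc 0 L), ?_⟩
  refine Lp.ext ?_
  filter_upwards [coeFn_ofContinuous hL (b.toContinuousMap.restrict (Set.Icc 0 L)),
    BoundedContinuousFunction.coeFn_toLp 2 (volume.restrict (Set.Icc 0 L)) ℂ b,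
    ae_restrict_mem measurableSet_Icc] with x h1 h2 hx
  rw [h1, h2, Set.IccExtend_of_mem _ _ hx]
  rfl

/-- Integration by parts. -/
theorem inner_primitive_add_inner_primitive (hL : 0 ≤ L) (h f : IntervalL2 L) :
    inner ℂ (ofContinuous hL (primitive L h)) f + inner ℂ h (ofContinuous hL (primitive L f))
      = starRingEnd ℂ (primitive L h ⟨L, hL, le_rfl⟩) * primitive L f ⟨L, hL, le_rfl⟩ := by
  have hev : Continuous fun u : C(Set.Icc (0 : ℝ) L, ℂ) => u ⟨L, hL, le_rfl⟩ :=
    continuous_eval_const _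
  -- Both sides are continuous in `(h, f)`, so it suffices to treat continuous integrands, whose
  -- primitives are differentiable everywhere.
  refine (denseRange_ofContinuous hL).induction_on₂ (p := fun h f : IntervalL2 L =>
    inner ℂ (ofContinuous hL (primitive L h)) f + inner ℂ h (ofContinuous hL (primitive L f))
      = starRingEnd ℂ (primitive L h ⟨L, hL, le_rfl⟩) * primitive L f ⟨L, hL, le_rfl⟩) ?_ ?_ h f
  · refine isClosed_eq ?_ ?_
    · fun_prop
    · refine Continuous.mul ?_ ?_
      · exact Complex.continuous_conj.comp (hev.comp ((primitive L).continuous.comp continuous_fst))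
      · exact hev.comp ((primitive L).continuous.comp continuous_snd)
  · intro u v
    set U := Set.IccExtend hL u
    set W := Set.IccExtend hL v
    have hU : Continuous U := u.continuous.Icc_extend'
    have hW : Continuous W := v.continuous.Icc_extend'
    have hprim (w : C(Set.Icc (0 : ℝ) L, ℂ)) :
        ofContinuous hL (primitive L (ofContinuous hL w)) =ᵐ[volume.restrict (Set.Icc 0 L)]
          fun x => ∫ t in (0 : ℝ)..x, Set.IccExtend hL w t := by
      filter_upwards [coeFn_ofContinuous hL (primitive L (ofContinuous hL w)),
        ae_restrict_mem measurableSet_Icc] with x h1 hx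
      rw [h1, Set.IccExtend_of_mem _ _ hx, primitive_ofContinuous]
    have hdU (x : ℝ) : HasDerivAt (fun x => starRingEnd ℂ (∫ t in (0 : ℝ)..x, U t))
        (starRingEnd ℂ (U x)) x :=
      (hU.integral_hasStrictDerivAt 0 x).hasDerivAt.star
    have hdW (x : ℝ) : HasDerivAt (fun x => ∫ t in (0 : ℝ)..x, W t) (W x) x :=
      (hW.integral_hasStrictDerivAt 0 x).hasDerivAt
    have hcU : Continuous fun x => starRingEnd ℂ (∫ t in (0 : ℝ)..x, U t) :=
      continuous_iff_continuousAt.2 fun x => (hdU x).continuousAt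
    have hcW : Continuous fun x => ∫ t in (0 : ℝ)..x, W t :=
      continuous_iff_continuousAt.2 fun x => (hdW x).continuousAt
    rw [inner_eq_integral hL (hprim u) (coeFn_ofContinuous hL v),
      inner_eq_integral hL (coeFn_ofContinuous hL u) (hprim v),
      primitive_ofContinuous, primitive_ofContinuous, add_comm,
      ← intervalIntegral.integral_add]
    · rw [intervalIntegral.integral_deriv_mul_eq_sub (fun x _ => hdU x) (fun x _ => hdW x)]
      · simp [U, W]
      · exact (Complex.continuous_conj.comp hU).intervalIntegrable _ _
      · exact hW.intervalIntegrable _ _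
    · exact ((Complex.continuous_conj.comp hU).mul hcW).intervalIntegrable _ _
    · exact (hcU.mul hW).intervalIntegrable _ _

/-- By Lebesgue differentiation the primitive has derivative `g` almost everywhere; the end points
are a null set. -/
theorem primitive_injective (L : ℝ) : Function.Injective (primitive L) := by
  refine (injective_iff_map_eq_zero _).2 fun g hg => ?_
  refine Lp.ext ?_
  refine Filter.EventuallyEq.trans ?_ (Lp.coeFn_zero _ _ _).symm
  suffices h : ∀ᵐ x ∂(volume.restrict (Set.Ioo 0 L)), g x = 0 by
    rwa [restrict_Ioo_eq_restrict_Icc] at h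
  rw [ae_restrict_iff' measurableSet_Ioo]
  by_cases hL : 0 ≤ L
  · have h0 : (0 : ℝ) ∈ Set.Icc 0 L := ⟨le_rfl, hL⟩
    have hint := g.intervalIntegrable h0 ⟨hL, le_rfl⟩
    filter_upwards [hint.ae_hasDerivAt_integral] with x hx hxL
    rw [Set.uIcc_of_le hL] at hx
    refine (hx ⟨hxL.1.le, hxL.2.le⟩ 0 h0).unique ?_
    refine (hasDerivAt_const x (0 : ℂ)).congr_of_eventuallyEq ?_
    filter_upwards [Ioo_mem_nhds hxL.1 hxL.2] with y hy
    exact DFunLike.congr_fun hg ⟨y, hy.1.le, hy.2.le⟩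
  · exact Filter.Eventually.of_forall fun x hx => absurd (hx.1.le.trans hx.2.le) hL

end IntervalL2

/-! ### Paths in the metric graph and walks in the discrete graph -/

namespace MetricGraph

variable {V E : Type*} {G : MetricGraph V E}

theorem HasPath.nonneg {p q : G.EdgePoint} {l : ℝ} (h : G.HasPath p q l) : 0 ≤ l := by
  induction h with
  | segment e x y => exact abs_nonneg _
  | glue p q v hp hq => exact le_rfl
  | trans p q r a b _ _ ha hb => exact add_nonneg ha hb

theorem HasPath.symm {p q : G.EdgePoint} {l : ℝ} (h : G.HasPath p q l) : G.HasPath q p l := by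
  induction h with
  | segment e x y => rw [abs_sub_comm]; exact .segment e y x
  | glue p q v hp hq => exact .glue q p v hq hp
  | trans p q r a b _ _ ha hb => rw [add_comm]; exact .trans _ _ _ _ _ hb ha

theorem dist_le_of_hasPath {p q : G.EdgePoint} {l : ℝ} (h : G.HasPath p q l) : G.dist p q ≤ l :=
  csInf_le ⟨0, fun _ h => h.nonneg⟩ h

/-- A function that is `1`-Lipschitz along the edges and consistent at the vertices is
`1`-Lipschitz along all paths. -/
theorem HasPath.abs_sub_le {ψ : G.EdgePoint → ℝ}
    (hψ : ∀ e x y, |ψ ⟨e, x⟩ - ψ ⟨e, y⟩| ≤ |(x : ℝ) - (y : ℝ)|)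
    (hv : ∀ p q v, G.IsAt p v → G.IsAt q v → ψ p = ψ q) {p q : G.EdgePoint} {l : ℝ}
    (h : G.HasPath p q l) : |ψ p - ψ q| ≤ l := by
  induction h with
  | segment e x y => exact hψ e x y
  | glue p q v hp hq => simp [hv p q v hp hq]
  | trans p q r a b _ _ ha hb => exact (_root_.abs_sub_le _ (ψ q) _).trans (add_le_add ha hb)

/-- The end `0` of the edge `e`. -/
def srcPoint (G : MetricGraph V E) (e : E) : G.EdgePoint := ⟨e, 0, le_rfl, (G.len_pos e).le⟩

/-- The end `len e` of the edge `e`. -/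
def tgtPoint (G : MetricGraph V E) (e : E) : G.EdgePoint :=
  ⟨e, G.len e, (G.len_pos e).le, le_rfl⟩

theorem isAt_srcPoint (e : E) : G.IsAt (G.srcPoint e) (G.src e) := Or.inl ⟨rfl, rfl⟩

theorem isAt_tgtPoint (e : E) : G.IsAt (G.tgtPoint e) (G.tgt e) := Or.inr ⟨rfl, rfl⟩

/-- The edge `e` connects the vertices `u` and `v`. -/
def Joins (G : MetricGraph V E) (e : E) (u v : V) : Prop := s(G.src e, G.tgt e) = s(u, v)

theorem Joins.exists_points {e : E} {u v : V} (h : G.Joins e u v) :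
    ∃ x y : Set.Icc (0 : ℝ) (G.len e), G.IsAt ⟨e, x⟩ u ∧ G.IsAt ⟨e, y⟩ v := by
  rcases Sym2.eq_iff.1 h with ⟨rfl, rfl⟩ | ⟨rfl, rfl⟩
  · exact ⟨_, _, isAt_srcPoint e, isAt_tgtPoint e⟩
  · exact ⟨_, _, isAt_tgtPoint e, isAt_srcPoint e⟩

theorem exists_joins_of_adj {u v : V} (h : G.toSimpleGraph.Adj u v) : ∃ e, G.Joins e u v := by
  rw [toSimpleGraph, SimpleGraph.fromEdgeSet_adj] at h
  exact h.1

theorem adj_of_joins (hG : G.IsTree) {e : E} {u v : V} (h : G.Joins e u v) :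
    G.toSimpleGraph.Adj u v := by
  rw [toSimpleGraph, SimpleGraph.fromEdgeSet_adj]
  refine ⟨⟨e, h⟩, ?_⟩
  rcases Sym2.eq_iff.1 h with ⟨rfl, rfl⟩ | ⟨rfl, rfl⟩
  · exact hG.1 e
  · exact (hG.1 e).symm

open Classical in
/-- The length of the edge with given pair of end vertices (`0` if there is none). -/
noncomputable def pairLen (G : MetricGraph V E) (s : Sym2 V) : ℝ :=
  if h : ∃ e, s(G.src e, G.tgt e) = s then G.len h.choose else 0

/-- Without parallel edges the choice in `pairLen` is forced. -/
theorem pairLen_eq (hG : G.IsTree) {e : E} {s : Sym2 V} (h : s(G.src e, G.tgt e) = s) :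
    G.pairLen s = G.len e := by
  have hex : ∃ e, s(G.src e, G.tgt e) = s := ⟨e, h⟩
  rw [pairLen, dif_pos hex]
  exact congrArg G.len (hG.2.1 (hex.choose_spec.trans h.symm))

/-- The metric length of a walk. -/
noncomputable def walkLen {u w : V} (p : G.toSimpleGraph.Walk u w) : ℝ :=
  (p.edges.map G.pairLen).sum

theorem walkLen_cons (hG : G.IsTree) {u v w : V} (h : G.toSimpleGraph.Adj u v)
    (p : G.toSimpleGraph.Walk v w) {e : E} (he : G.Joins e u v) :
    walkLen (.cons h p) = G.len e + walkLen p := by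
  simp [walkLen, pairLen_eq hG he]

theorem walkLen_nonneg {u w : V} (p : G.toSimpleGraph.Walk u w) : 0 ≤ walkLen p := by
  refine List.sum_nonneg fun x hx => ?_
  obtain ⟨s, _, rfl⟩ := List.mem_map.1 hx
  rw [pairLen]
  split_ifs with h
  · exact (G.len_pos _).le
  · exact le_rfl

theorem abs_sub_le_len {e : E} (x y : Set.Icc (0 : ℝ) (G.len e)) :
    |(x : ℝ) - (y : ℝ)| ≤ G.len e :=
  abs_sub_le_of_nonneg_of_le x.2.1 x.2.2 y.2.1 y.2.2

/-- From the start of a walk one reaches the points of its edges by paths not longer than it. -/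
theorem exists_hasPath_from_start (hG : G.IsTree) {u w : V} (p : G.toSimpleGraph.Walk u w)
    {r q : G.EdgePoint} (hr : G.IsAt r u) (hq : s(G.src q.1, G.tgt q.1) ∈ p.edges) :
    ∃ l ≤ walkLen p, G.HasPath r q l := by
  induction p generalizing r with
  | nil => simp at hq
  | @cons u v w h p ih =>
    obtain ⟨e, he⟩ := exists_joins_of_adj h
    obtain ⟨x, y, hx, hy⟩ := he.exists_points
    rw [walkLen_cons hG h p he]
    rw [SimpleGraph.Walk.edges_cons, List.mem_cons] at hq
    rcases hq with hq | hq
    · obtain rfl : q.1 = e := hG.2.1 (hq.trans he.symm)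
      refine ⟨0 + |(x : ℝ) - q.2|, ?_, .trans _ ⟨q.1, x⟩ _ _ _ (.glue _ _ u hr hx)
        (.segment q.1 x q.2)⟩
      linarith [abs_sub_le_len x q.2, walkLen_nonneg p]
    · obtain ⟨l, hl, hp⟩ := ih hy hq
      refine ⟨0 + (|(x : ℝ) - y| + l), ?_, .trans _ ⟨e, x⟩ _ _ _ (.glue _ _ u hr hx)
        (.trans _ _ _ _ _ (.segment e x y) hp)⟩
      linarith [abs_sub_le_len x y]

/-- Two points on the edges of a walk are connected by a path that is not longer than it. -/
theorem exists_hasPath_of_mem_edges (hG : G.IsTree) {u w : V} (p : G.toSimpleGraph.Walk u w)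
    {q q' : G.EdgePoint} (hq : s(G.src q.1, G.tgt q.1) ∈ p.edges)
    (hq' : s(G.src q'.1, G.tgt q'.1) ∈ p.edges) :
    ∃ l ≤ walkLen p, G.HasPath q q' l := by
  induction p with
  | nil => simp at hq
  | @cons u v w h p ih =>
    obtain ⟨e, he⟩ := exists_joins_of_adj h
    obtain ⟨x, y, hx, hy⟩ := he.exists_points
    rw [walkLen_cons hG h p he]
    rw [SimpleGraph.Walk.edges_cons, List.mem_cons] at hq hq'
    have key (r r' : G.EdgePoint) (hr : s(G.src r.1, G.tgt r.1) = s(u, v))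
        (hr' : s(G.src r'.1, G.tgt r'.1) ∈ p.edges) :
        ∃ l ≤ G.len e + walkLen p, G.HasPath r r' l := by
      obtain rfl : r.1 = e := hG.2.1 (hr.trans he.symm)
      obtain ⟨l, hl, hp⟩ := exists_hasPath_from_start hG p hy hr'
      exact ⟨_, by linarith [abs_sub_le_len r.2 y], .trans _ _ _ _ _ (.segment r.1 r.2 y) hp⟩
    rcases hq with hq | hq <;> rcases hq' with hq' | hq'
    · obtain ⟨e₁, x₁⟩ := q
      obtain ⟨e₂, x₂⟩ := q'
      obtain rfl : e₁ = e := hG.2.1 (hq.trans he.symm)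
      obtain rfl : e₂ = e₁ := hG.2.1 (hq'.trans he.symm)
      exact ⟨_, by linarith [abs_sub_le_len x₁ x₂, walkLen_nonneg p], .segment e₂ x₁ x₂⟩
    · exact key q q' hq hq'
    · obtain ⟨l, hl, hp⟩ := key q' q hq' hq
      exact ⟨l, hl, hp.symm⟩
    · obtain ⟨l, hl, hp⟩ := ih hq hq'
      exact ⟨l, by linarith [G.len_pos e], hp⟩

end MetricGraph

/-! ### Paths through two given edges of a tree -/

namespace SimpleGraph.IsTree

variable {V : Type*} {T : SimpleGraph V}

/-- In a tree, every edge and every vertex lie on a common path that ends at the vertex. -/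
theorem exists_isPath_mem_edges (hT : T.IsTree) {a b : V} (hab : T.Adj a b) (c : V) :
    ∃ (x : V) (p : T.Walk x c), p.IsPath ∧ s(a, b) ∈ p.edges := by
  obtain ⟨q, hq, -⟩ := hT.existsUnique_path a c
  -- If the path from `a` to `c` visits `b`, acyclicity makes `ab` its first edge; otherwise `ab`
  -- can be put in front of it.
  by_cases hb : b ∈ q.support
  · refine ⟨a, q, hq, ?_⟩
    rw [hT.isAcyclic.eq_snd_of_adj_start hq hab hb]
    refine q.mk_start_snd_mem_edges ?_
    intro hnil
    rw [SimpleGraph.Walk.nil_iff_support_eq.1 hnil, List.mem_singleton] at hb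
    exact hab.ne hb.symm
  · exact ⟨b, .cons hab.symm q, hq.cons hb, by simp [Sym2.eq_swap]⟩

/-- In a tree, any two edges lie on a common path. -/
theorem exists_isPath_mem_edges_mem_edges (hT : T.IsTree) {a b c d : V} (hab : T.Adj a b)
    (hcd : T.Adj c d) :
    ∃ (x y : V) (p : T.Walk x y), p.IsPath ∧ s(a, b) ∈ p.edges ∧ s(c, d) ∈ p.edges := by
  obtain ⟨x, p, hp, hab'⟩ := hT.exists_isPath_mem_edges hab c
  by_cases hd : d ∈ p.support
  · refine ⟨x, c, p, hp, hab', ?_⟩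
    rw [hT.isAcyclic.eq_penultimate_of_adj_end hp hcd hd, Sym2.eq_swap]
    refine p.mk_penultimate_end_mem_edges ?_
    intro hnil
    rw [SimpleGraph.Walk.nil_iff_support_eq.1 hnil, List.mem_singleton, hnil.eq] at hd
    exact hcd.ne hd.symm
  · exact ⟨x, d, p.concat hcd, hp.concat hd hcd, by simp [hab'], by simp⟩

end SimpleGraph.IsTree

/-! ### Unfolding of trails, and the diameter -/

namespace MetricGraph

variable {V E : Type*} {G : MetricGraph V E}

/-- The walk runs through the whole edges carrying `q` and `q'`, so points inside edges never have
to become vertices. -/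
theorem exists_isPath_dist_le (hG : G.IsTree) (q q' : G.EdgePoint) :
    ∃ (u w : V) (p : G.toSimpleGraph.Walk u w), p.IsPath ∧ G.dist q q' ≤ walkLen p := by
  obtain ⟨u, w, p, hp, hq, hq'⟩ := hG.2.2.exists_isPath_mem_edges_mem_edges
    (adj_of_joins hG (e := q.1) rfl) (adj_of_joins hG (e := q'.1) rfl)
  obtain ⟨l, hl, hl'⟩ := exists_hasPath_of_mem_edges hG p hq hq'
  exact ⟨u, w, p, hp, (dist_le_of_hasPath hl').trans hl⟩

/-- A trail in a tree can be unfolded to an interval: its edges correspond to subintervals that are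
placed one after the other, by affine maps `x ↦ β e + σ e * x` with slopes `σ e = ±1`. -/
theorem exists_unfolding (hG : G.IsTree) {u w : V} (p : G.toSimpleGraph.Walk u w) (hp : p.IsTrail)
    (s : ℝ) :
    ∃ (S : Finset E) (σ β : E → ℝ), (∀ e ∈ S, s(G.src e, G.tgt e) ∈ p.edges) ∧
      (∀ e ∈ S, σ e = 1 ∨ σ e = -1) ∧
      (∀ F : ℝ → ℝ, Continuous F →
        ∑ e ∈ S, ∫ x in (0 : ℝ)..G.len e, F (β e + σ e * x) = ∫ x in s..s + walkLen p, F x) ∧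
      ∀ (a : V → ℂ) (φ : ℝ → ℂ),
        (∀ e ∈ S, a (G.tgt e) - a (G.src e) = φ (β e + σ e * G.len e) - φ (β e)) →
        ∀ e ∈ S, a (G.src e) - φ (β e) = a u - φ s := by
  classical
  induction p generalizing s with
  | nil => exact ⟨∅, 0, 0, by simp, by simp, by simp [walkLen], by simp⟩
  | @cons u v w h p ih =>
    rw [SimpleGraph.Walk.isTrail_cons] at hp
    obtain ⟨e, he⟩ := exists_joins_of_adj h
    obtain ⟨S, σ, β, hS, hσ, hF, ha⟩ := ih hp.1 (s + G.len e)
    -- A trail does not traverse an edge twice, so the pieces for different edges do not compete.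
    have heS : e ∉ S := fun hmem => hp.2 (he ▸ hS e hmem)
    have hne : ∀ e' ∈ S, e' ≠ e := fun e' h' => ne_of_mem_of_not_mem h' heS
    rw [walkLen_cons hG h p he]
    -- The first edge covers `[s, s + len e]`: forwards from `β₀ = s`, or backwards from `β₀ = s +
    -- len e` if the trail runs against its orientation. In both cases the discrepancy `a - φ` is
    -- carried unchanged from `u` to `v`, which makes it the same constant along the whole trail.
    obtain ⟨σ₀, β₀, hσ₀, hI, hA⟩ : ∃ σ₀ β₀ : ℝ, (σ₀ = 1 ∨ σ₀ = -1) ∧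
        (∀ F : ℝ → ℝ, ∫ x in (0 : ℝ)..G.len e, F (β₀ + σ₀ * x) = ∫ x in s..s + G.len e, F x) ∧
        ∀ (a : V → ℂ) (φ : ℝ → ℂ),
          a (G.tgt e) - a (G.src e) = φ (β₀ + σ₀ * G.len e) - φ β₀ →
          a (G.src e) - φ β₀ = a u - φ s ∧ a v - φ (s + G.len e) = a u - φ s := by
      rcases Sym2.eq_iff.1 he with ⟨rfl, rfl⟩ | ⟨rfl, rfl⟩
      · refine ⟨1, s, Or.inl rfl, fun F => ?_, fun a φ h => ⟨rfl, ?_⟩⟩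
        · simp
        · rw [one_mul] at h
          linear_combination h
      · refine ⟨-1, s + G.len e, Or.inr rfl, fun F => ?_, fun a φ h => ?_⟩
        · simp [← sub_eq_add_neg]
        · have : s + G.len e + -1 * G.len e = s := by ring
          rw [this] at h
          constructor <;> linear_combination -h
    refine ⟨insert e S, Function.update σ e σ₀, Function.update β e β₀, ?_, ?_, ?_, ?_⟩
    · simp only [Finset.forall_mem_insert, SimpleGraph.Walk.edges_cons, List.mem_cons]
      exact ⟨Or.inl he, fun e' h' => Or.inr (hS e' h')⟩
    · simp only [Finset.forall_mem_insert, Function.update_self]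
      refine ⟨hσ₀, fun e' h' => ?_⟩
      rw [Function.update_of_ne (hne e' h')]
      exact hσ e' h'
    · intro F hFc
      rw [Finset.sum_insert heS, Function.update_self, Function.update_self, hI, ← add_assoc,
        ← intervalIntegral.integral_add_adjacent_intervals (hFc.intervalIntegrable s (s + G.len e))
          (hFc.intervalIntegrable _ (s + G.len e + walkLen p)), ← hF F hFc]
      congr 1
      refine Finset.sum_congr rfl fun e' h' => ?_
      rw [Function.update_of_ne (hne e' h'), Function.update_of_ne (hne e' h')]
    · intro a φ hφ
      simp only [Finset.forall_mem_insert, Function.update_self] at hφ ⊢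
      have h1 := hA a φ hφ.1
      refine ⟨h1.1, fun e' h' => ?_⟩
      rw [Function.update_of_ne (hne e' h'), ← h1.2]
      refine ha a φ (fun e'' h'' => ?_) e' h'
      have := hφ.2 e'' h''
      rwa [Function.update_of_ne (hne e'' h''), Function.update_of_ne (hne e'' h'')] at this

theorem walkLen_le_sum_len [Fintype E] (hG : G.IsTree) {u w : V} (p : G.toSimpleGraph.Walk u w)
    (hp : p.IsTrail) : walkLen p ≤ ∑ e, G.len e := by
  obtain ⟨S, σ, β, -, -, hF, -⟩ := exists_unfolding hG p hp 0
  have := hF (fun _ => 1) continuous_const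
  simp only [intervalIntegral.integral_const, smul_eq_mul, mul_one, sub_zero, zero_add] at this
  rw [← this]
  exact Finset.sum_le_sum_of_subset_of_nonneg (Finset.subset_univ S) fun e _ _ => (G.len_pos e).le

/-- Needed because a real `sSup` dominates the individual distances only when the set is bounded. -/
theorem bddAbove_dist [Fintype E] (hG : G.IsTree) :
    BddAbove {d : ℝ | ∃ p q : G.EdgePoint, d = G.dist p q} := by
  refine ⟨∑ e, G.len e, ?_⟩
  rintro _ ⟨q, q', rfl⟩
  obtain ⟨u, w, p, hp, h⟩ := exists_isPath_dist_le hG q q'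
  exact h.trans (walkLen_le_sum_len hG p hp.isTrail)

theorem diam_pos [Fintype E] [Nonempty E] (hG : G.IsTree) : 0 < G.diam := by
  classical
  obtain ⟨e⟩ := ‹Nonempty E›
  have hL := G.len_pos e
  let m : Set.Icc (0 : ℝ) (G.len e) := ⟨G.len e / 2, by constructor <;> linarith⟩
  have hle : G.len e / 2 ≤ G.dist (G.srcPoint e) ⟨e, m⟩ := by
    refine le_csInf ⟨_, .segment e _ m⟩ fun l hl => ?_
    -- A tent over `e`, vanishing at all vertices. Being 1-Lipschitz along paths, it bounds from
    -- below the length of every path to the midpoint.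
    let ψ : G.EdgePoint → ℝ := fun p => if p.1 = e then min (p.2 : ℝ) (G.len p.1 - p.2) else 0
    have hψ : ∀ e x y, |ψ ⟨e, x⟩ - ψ ⟨e, y⟩| ≤ |(x : ℝ) - (y : ℝ)| := by
      intro e' x y
      by_cases h : e' = e
      · simp only [ψ, h, if_true]
        refine (abs_min_sub_min_le_max _ _ _ _).trans ?_
        rw [max_le_iff]
        refine ⟨le_rfl, le_of_eq ?_⟩
        rw [abs_sub_comm]
        congr 1
        ring
      · simp [ψ, h]
    have hv : ∀ p v, G.IsAt p v → ψ p = 0 := by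
      rintro p v (⟨h, -⟩ | ⟨h, -⟩)
      · simp [ψ, h, (G.len_pos p.1).le]
      · simp [ψ, h, (G.len_pos p.1).le]
    have := HasPath.abs_sub_le hψ (fun p q v hp hq => (hv p v hp).trans (hv q v hq).symm) hl
    rw [hv _ _ (isAt_srcPoint e)] at this
    have hm : ψ ⟨e, m⟩ = G.len e / 2 := by
      simp only [ψ, m, if_true]
      rw [min_eq_left]
      linarith
    rw [hm, zero_sub, abs_neg, abs_of_pos (by linarith)] at this
    exact this
  have := le_csSup (bddAbove_dist hG) ⟨_, _, rfl⟩ |>.trans' hle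
  rw [diam]
  linarith

/-- There are paths whose length exceeds any given number below the diameter. -/
theorem exists_isPath_lt_walkLen [Fintype E] [Nonempty E] (hG : G.IsTree) {r : ℝ}
    (hr : r < G.diam) :
    ∃ (u w : V) (p : G.toSimpleGraph.Walk u w), p.IsPath ∧ r < walkLen p := by
  obtain ⟨e⟩ := ‹Nonempty E›
  obtain ⟨_, ⟨q, q', rfl⟩, h⟩ := exists_lt_of_lt_csSup
    (s := {d : ℝ | ∃ p q : G.EdgePoint, d = G.dist p q})
    ⟨_, G.srcPoint e, G.srcPoint e, rfl⟩ hr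
  obtain ⟨u, w, p, hp, h'⟩ := exists_isPath_dist_le hG q q'
  exact ⟨u, w, p, hp, h.trans_le h'⟩

end MetricGraph

/-! ### The du Bois-Reymond lemma -/

namespace IntervalL2

variable {L : ℝ}

theorem inner_ofContinuous_one (hL : 0 ≤ L) (q : IntervalL2 L) :
    inner ℂ (ofContinuous hL 1) q = primitive L q ⟨L, hL, le_rfl⟩ := by
  rw [primitive_apply, inner_eq_integral (u := fun _ => 1) (v := q) hL (coeFn_ofContinuous hL 1)
    Filter.EventuallyEq.rfl]
  simp

theorem primitive_ofContinuous_one (hL : 0 ≤ L) (x : Set.Icc (0 : ℝ) L) :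
    primitive L (ofContinuous hL 1) x = (x : ℝ) := by
  rw [primitive_ofContinuous]
  refine (intervalIntegral.integral_congr (g := fun _ => 1) fun _ _ => rfl).trans ?_
  simp

/-- **du Bois-Reymond lemma** in `L²(0, L)`. -/
theorem exists_eq_smul_one (hL : 0 ≤ L) {w : IntervalL2 L}
    (hw : ∀ q : IntervalL2 L, primitive L q ⟨L, hL, le_rfl⟩ = 0 → inner ℂ q w = 0) :
    ∃ b : ℂ, w = b • ofContinuous hL 1 := by
  -- The hypothesis tests `w` against everything orthogonal to `1`, and a line is its own double
  -- orthogonal complement.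
  have hmem : w ∈ (ℂ ∙ ofContinuous hL 1)ᗮᗮ := by
    rw [Submodule.mem_orthogonal]
    intro q hq
    refine hw q ?_
    rw [← inner_ofContinuous_one hL]
    exact Submodule.mem_orthogonal_singleton_iff_inner_right.1 hq
  rw [Submodule.orthogonal_orthogonal] at hmem
  obtain ⟨b, hb⟩ := Submodule.mem_span_singleton.1 hmem
  exact ⟨b, hb.symm⟩

end IntervalL2

/-! ### Functions on the graph given by derivatives, and weak eigenfunctions -/

namespace MetricGraph

open IntervalL2

variable {V E : Type*} {G : MetricGraph V E}

theorem hasSobolevDeriv_IccExtend {L : ℝ} (hL : 0 ≤ L) (u v : C(Set.Icc (0 : ℝ) L, ℂ))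
    (h : ∀ x, u x = u ⟨0, le_rfl, hL⟩ + primitive L (ofContinuous hL v) x) :
    HasSobolevDeriv L (Set.IccExtend hL u) (Set.IccExtend hL v) := by
  refine ⟨memLp_IccExtend hL v, fun x hx => ?_⟩
  rw [Set.IccExtend_of_mem _ _ hx, Set.IccExtend_of_mem hL u (x := 0) ⟨le_rfl, hL⟩, h ⟨x, hx⟩,
    primitive_ofContinuous]

/-- The space `L²(G)`. -/
abbrev EdgeL2 (G : MetricGraph V E) [Fintype E] : Type _ := PiLp 2 fun e : E => IntervalL2 (G.len e)

/-- The function on the edge `e` with value `a (src e)` at `0` and derivative `g e`. -/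
noncomputable def edgeFun (G : MetricGraph V E) [Fintype E] (e : E) :
    (V → ℂ) × G.EdgeL2 →L[ℂ] C(Set.Icc (0 : ℝ) (G.len e), ℂ) :=
  ((ContinuousLinearMap.proj (R := ℂ) (φ := fun _ : V => ℂ) (G.src e)).smulRight
      (1 : C(Set.Icc (0 : ℝ) (G.len e), ℂ))) ∘L ContinuousLinearMap.fst ℂ _ _ +
    (primitive (G.len e) ∘L PiLp.proj 2 _ e) ∘L ContinuousLinearMap.snd ℂ _ _

theorem IsTree.eq_of_src_eq_tgt (hG : G.IsTree) {a : V → ℂ}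
    (ha : ∀ e, a (G.tgt e) = a (G.src e)) (u v : V) : a u = a v := by
  obtain ⟨p⟩ := hG.2.2.connected.preconnected u v
  induction p with
  | nil => rfl
  | cons h p ih =>
    rw [← ih]
    obtain ⟨e, he⟩ := exists_joins_of_adj h
    rcases Sym2.eq_iff.1 he with ⟨rfl, rfl⟩ | ⟨rfl, rfl⟩
    · exact (ha e).symm
    · exact ha e

variable [Fintype E]

theorem edgeFun_eq (e : E) (a : V → ℂ) (g : G.EdgeL2) :
    G.edgeFun e (a, g) = a (G.src e) • 1 + primitive (G.len e) (g e) := rfl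

theorem edgeFun_apply (e : E) (a : V → ℂ) (g : G.EdgeL2) (x : Set.Icc (0 : ℝ) (G.len e)) :
    G.edgeFun e (a, g) x = a (G.src e) + primitive (G.len e) (g e) x := by
  simp [edgeFun_eq]

/-- The function on `G` that is given by `edgeFun` on each edge. -/
noncomputable def graphFun (G : MetricGraph V E) : (V → ℂ) × G.EdgeL2 →ₗ[ℂ] (G.EdgePoint → ℂ) where
  toFun x p := G.edgeFun p.1 x p.2
  map_add' x y := by ext p; simp
  map_smul' c x := by ext p; simp

theorem onEdge_graphFun (x : (V → ℂ) × G.EdgeL2) (e : E) :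
    onEdge (G.graphFun x) e = Set.IccExtend (G.len_pos e).le (G.edgeFun e x) := rfl

/-- The class of `graphFun` in `L²(G)`. -/
noncomputable def graphL2 (G : MetricGraph V E) : (V → ℂ) × G.EdgeL2 →L[ℂ] G.EdgeL2 :=
  ((PiLp.continuousLinearEquiv 2 ℂ fun e : E => IntervalL2 (G.len e)).symm :
      (∀ e : E, IntervalL2 (G.len e)) →L[ℂ] G.EdgeL2) ∘L
    ContinuousLinearMap.pi fun e => ofContinuous (G.len_pos e).le ∘L G.edgeFun e

theorem graphL2_apply (x : (V → ℂ) × G.EdgeL2) (e : E) :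
    G.graphL2 x e = ofContinuous (G.len_pos e).le (G.edgeFun e x) := rfl

theorem norm_graphL2_sq (x : (V → ℂ) × G.EdgeL2) : ‖G.graphL2 x‖ ^ 2 =
    ∑ e, ∫ t in (0 : ℝ)..G.len e, ‖Set.IccExtend (G.len_pos e).le (G.edgeFun e x) t‖ ^ 2 := by
  rw [PiLp.norm_sq_eq_of_L2]
  exact Finset.sum_congr rfl fun e _ => norm_ofContinuous_sq _ _

/-- The vertex values `a` are compatible with the derivative `g`, so that `graphFun (a, g)` is
continuous. -/
def IsCompat (G : MetricGraph V E) (a : V → ℂ) (g : G.EdgeL2) : Prop :=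
  ∀ e, a (G.tgt e) - a (G.src e) = primitive (G.len e) (g e) ⟨G.len e, (G.len_pos e).le, le_rfl⟩

theorem IsCompat.graphFun_eq {a : V → ℂ} {g : G.EdgeL2} (h : G.IsCompat a g) {p : G.EdgePoint}
    {v : V} (hp : G.IsAt p v) : G.graphFun (a, g) p = a v := by
  obtain ⟨e, x, hx⟩ := p
  refine (edgeFun_apply e a g _).trans ?_
  rcases hp with ⟨h0, rfl⟩ | ⟨h1, rfl⟩
  · obtain rfl : x = 0 := h0
    simp [primitive_apply]
  · obtain rfl : x = G.len e := h1
    rw [← h e]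
    ring

/-- Integration by parts on each edge. The primitive of `q` vanishes at the end `0`, so only the
boundary term at `tgt e` survives. -/
theorem inner_graphL2 {φ : V → ℂ} {h : G.EdgeL2} (hφ : G.IsCompat φ h) (q : G.EdgeL2) :
    inner ℂ (G.graphL2 (φ, h)) q = ∑ e, (starRingEnd ℂ (φ (G.tgt e)) *
        primitive (G.len e) (q e) ⟨G.len e, (G.len_pos e).le, le_rfl⟩ -
      inner ℂ (h e) (ofContinuous (G.len_pos e).le (primitive (G.len e) (q e)))) := by
  rw [PiLp.inner_apply]
  refine Finset.sum_congr rfl fun e _ => ?_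
  have h1 := inner_primitive_add_inner_primitive (G.len_pos e).le (h e) (q e)
  rw [graphL2_apply, edgeFun_eq, map_add, map_smul, inner_add_left, inner_smul_left,
    inner_ofContinuous_one, ← sub_add_cancel (φ (G.tgt e)) (φ (G.src e)), hφ e, map_add]
  linear_combination h1

/-- Weak eigenfunctions are eigenfunctions. -/
theorem IsCompat.isLaplacian [DecidableEq V] {a : V → ℂ} {g : G.EdgeL2} (ha : G.IsCompat a g)
    {t : ℝ} (ht : t ≠ 0) (hweak : ∀ φ h, G.IsCompat φ h →
      inner ℂ (G.graphL2 (φ, h)) (G.graphL2 (a, g)) = t * inner ℂ h g) :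
    G.IsLaplacian (G.graphFun (a, g))
      (fun e x => ((t⁻¹ : ℝ) : ℂ) * onEdge (G.graphFun (a, g)) e x) := by
  classical
  have htC : (t : ℂ) ≠ 0 := by exact_mod_cast ht
  let F (e : E) := primitive (G.len e) (G.graphL2 (a, g) e)
  -- For an eigenfunction u with derivative `g` one expects `t g' = -u`, and `F` is a primitive of
  -- u; hence `w` should be constant on each edge.
  let w (e : E) : IntervalL2 (G.len e) := (t : ℂ) • g e + ofContinuous (G.len_pos e).le (F e)
  have hw : ∀ φ h, G.IsCompat φ h → ∑ e, inner ℂ (h e) (w e) =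
      ∑ e, starRingEnd ℂ (φ (G.tgt e)) * F e ⟨G.len e, (G.len_pos e).le, le_rfl⟩ := by
    intro φ h hφ
    have h1 := hweak φ h hφ
    rw [inner_graphL2 hφ, PiLp.inner_apply, Finset.sum_sub_distrib, Finset.mul_sum,
      sub_eq_iff_eq_add, ← Finset.sum_add_distrib] at h1
    rw [h1]
    refine Finset.sum_congr rfl fun e _ => ?_
    rw [inner_add_right, inner_smul_right]
  have hb (e : E) : ∃ b : ℂ, w e = b • ofContinuous (G.len_pos e).le 1 := by
    refine exists_eq_smul_one (G.len_pos e).le fun q hq => ?_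
    -- Test functions supported in a single edge and vanishing at all vertices: their derivatives
    -- are the mean-zero `q`.
    have h1 := hw 0 (WithLp.toLp 2 (Pi.single e q)) (by
      intro e'
      by_cases h : e' = e
      · subst h
        simpa using hq.symm
      · simp [Pi.single_eq_of_ne h])
    rw [Finset.sum_eq_single e (by
      intro e' _ h
      simp [Pi.single_eq_of_ne h]) (by simp)] at h1
    simpa using h1
  choose b hb using hb
  -- Solving `t g + F = b` for `g` yields its continuous representative, which again has a
  -- derivative in L².
  let D (e : E) : C(Set.Icc (0 : ℝ) (G.len e), ℂ) := (t : ℂ)⁻¹ • (b e • 1 - F e)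
  have hD (e : E) : ofContinuous (G.len_pos e).le (D e) = g e := by
    simp only [D, map_smul, map_sub, ← hb e, w, add_sub_cancel_right, smul_smul,
      inv_mul_cancel₀ htC, one_smul]
  refine ⟨fun e => Set.IccExtend (G.len_pos e).le (D e), fun e => ?_, fun e => ?_,
    fun v p q hp hq => (ha.graphFun_eq hp).trans (ha.graphFun_eq hq).symm, fun v => ?_⟩
  · rw [onEdge_graphFun]
    refine hasSobolevDeriv_IccExtend _ _ _ fun x => ?_
    rw [hD, edgeFun_apply, edgeFun_apply]
    simp [primitive_apply]
  · have : (fun x => -(((t⁻¹ : ℝ) : ℂ) * onEdge (G.graphFun (a, g)) e x)) =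
        Set.IccExtend (G.len_pos e).le (-((t : ℂ)⁻¹ • G.edgeFun e (a, g))) := by
      funext x
      simp [onEdge_graphFun, Set.IccExtend]
    rw [this]
    refine hasSobolevDeriv_IccExtend _ _ _ fun x => ?_
    rw [map_neg, map_smul, ← graphL2_apply, map_neg, map_smul]
    simp [D, F, primitive_apply]
    ring
  -- The hat function at `v`, affine on every edge. Testing with it isolates the vertex condition at
  -- `v`.
  · let φ : V → ℂ := Pi.single v 1
    let h : G.EdgeL2 := WithLp.toLp 2 fun e =>
      ((φ (G.tgt e) - φ (G.src e)) / G.len e) • ofContinuous (G.len_pos e).le 1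
    have hφ : G.IsCompat φ h := by
      intro e
      have hL : (G.len e : ℂ) ≠ 0 := by exact_mod_cast (G.len_pos e).ne'
      simp only [h, map_smul, ContinuousMap.smul_apply, primitive_ofContinuous_one, smul_eq_mul]
      field_simp
    have h1 := hw φ h hφ
    have hreal (u : V) : starRingEnd ℂ (φ u) = φ u := by
      by_cases hu : u = v
      · subst hu; simp [φ]
      · simp [φ, Pi.single_eq_of_ne hu]
    have h2 : ∑ e, (φ (G.tgt e) - φ (G.src e)) * b e =
        ∑ e, φ (G.tgt e) * F e ⟨G.len e, (G.len_pos e).le, le_rfl⟩ := by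
      simp only [hreal] at h1
      refine Eq.trans (Finset.sum_congr rfl fun e _ => ?_) h1
      have hL : (G.len e : ℂ) ≠ 0 := by exact_mod_cast (G.len_pos e).ne'
      rw [hb]
      simp only [h, inner_smul_left, inner_smul_right, inner_ofContinuous_one,
        primitive_ofContinuous_one, map_div₀, map_sub, hreal, Complex.conj_ofReal]
      field_simp
    have hsplit (u : V) (z : ℂ) : (if u = v then z else 0) = φ u * z := by
      by_cases hu : u = v
      · subst hu; simp [φ]
      · simp [φ, hu]
    simp only [hsplit]
    rw [← Finset.sum_sub_distrib]
    have hD1 (e : E) : Set.IccExtend (G.len_pos e).le (D e) (G.len e) =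
        (t : ℂ)⁻¹ * (b e - F e ⟨G.len e, (G.len_pos e).le, le_rfl⟩) := by
      rw [Set.IccExtend_right]
      simp [D]
    have hD0 (e : E) : Set.IccExtend (G.len_pos e).le (D e) 0 = (t : ℂ)⁻¹ * b e := by
      rw [Set.IccExtend_left]
      simp [D, F, primitive_apply]
    simp only [hD1, hD0]
    rw [← sub_eq_zero, ← Finset.sum_sub_distrib] at h2
    rw [← mul_zero (t : ℂ)⁻¹, ← h2, Finset.mul_sum]
    refine Finset.sum_congr rfl fun e _ => ?_
    ring

/-- Only this half of Euler's formula is needed for the dimension count that makes the difference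
map V → E surjective. -/
theorem IsTree.card_add_one_le [Fintype V] (hG : G.IsTree) :
    Fintype.card E + 1 ≤ Fintype.card V := by
  classical
  rw [← hG.2.2.card_edgeFinset, add_le_add_iff_right, ← Finset.card_univ]
  refine Finset.card_le_card_of_injOn (fun e => s(G.src e, G.tgt e)) (fun e _ => ?_)
    hG.2.1.injOn
  simpa using adj_of_joins hG (e := e) rfl

/-- On a tree, every system of increments along the edges has a potential. -/
theorem IsTree.exists_potential [Fintype V] (hG : G.IsTree) :
    ∃ B : (E → ℂ) →ₗ[ℂ] (V → ℂ), ∀ z e, B z (G.tgt e) - B z (G.src e) = z e := by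
  let δ : (V → ℂ) →ₗ[ℂ] (E → ℂ) :=
    LinearMap.funLeft ℂ ℂ G.tgt - LinearMap.funLeft ℂ ℂ G.src
  have hker : Module.finrank ℂ (LinearMap.ker δ) ≤ 1 := by
    refine (Submodule.finrank_mono (t := ℂ ∙ (1 : V → ℂ)) fun a ha => ?_).trans
      ((finrank_span_le_card _).trans (by simp))
    have ha' : ∀ e, a (G.tgt e) = a (G.src e) := fun e =>
      sub_eq_zero.1 (congrFun (LinearMap.mem_ker.1 ha) e)
    obtain ⟨v⟩ := hG.2.2.connected.nonempty
    refine Submodule.mem_span_singleton.2 ⟨a v, ?_⟩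
    ext u
    simpa using hG.eq_of_src_eq_tgt ha' v u
  have hsurj : LinearMap.range δ = ⊤ := by
    refine Submodule.eq_top_of_finrank_eq (le_antisymm (Submodule.finrank_le _) ?_)
    have h1 := LinearMap.finrank_range_add_finrank_ker δ
    have h2 := hG.card_add_one_le
    simp only [Module.finrank_fintype_fun_eq_card] at h1 ⊢
    omega
  obtain ⟨B, hB⟩ := δ.exists_rightInverse_of_surjective hsurj
  exact ⟨B, fun z e => congrFun (LinearMap.congr_fun hB z) e⟩

/-- The constant function `1` in `L²(G)`. -/
noncomputable def oneL2 (G : MetricGraph V E) : G.EdgeL2 := G.graphL2 (1, 0)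

theorem inner_oneL2_self_ne_zero [Nonempty E] : inner ℂ G.oneL2 G.oneL2 ≠ 0 := by
  rw [inner_self_ne_zero]
  intro h
  obtain ⟨e⟩ := ‹Nonempty E›
  have h1 : G.oneL2 e = 0 := by rw [h]; rfl
  have h2 : G.oneL2 e = ofContinuous (G.len_pos e).le 1 := by
    rw [oneL2, graphL2_apply, edgeFun_eq]
    simp
  have h3 := primitive_ofContinuous_one (G.len_pos e).le ⟨G.len e, (G.len_pos e).le, le_rfl⟩
  rw [← h2, h1, map_zero] at h3
  have h4 : (0 : ℂ) = (G.len e : ℝ) := h3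
  exact (G.len_pos e).ne (by exact_mod_cast h4)

theorem graphL2_add_const (a : V → ℂ) (c : ℂ) (g : G.EdgeL2) :
    G.graphL2 (a + c • 1, g) = G.graphL2 (a, g) + c • G.oneL2 := by
  rw [oneL2, ← map_smul, ← map_add]
  simp

/-- On a tree, every derivative in `L²` has a primitive that is continuous at the vertices and
orthogonal to the constants. -/
theorem IsTree.exists_primitive [Fintype V] [Nonempty E] (hG : G.IsTree) :
    ∃ C : G.EdgeL2 →L[ℂ] (V → ℂ), (∀ g, G.IsCompat (C g) g) ∧
      ∀ g, inner ℂ G.oneL2 (G.graphL2 (C g, g)) = 0 := by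
  obtain ⟨B, hB⟩ := hG.exists_potential
  let ends : G.EdgeL2 →ₗ[ℂ] (E → ℂ) :=
    LinearMap.pi fun e =>
      { toFun := fun g => primitive (G.len e) (g e) ⟨G.len e, (G.len_pos e).le, le_rfl⟩
        map_add' := fun g h => by simp
        map_smul' := fun c g => by simp }
  have hends : Continuous ends := by
    refine continuous_pi fun e => ?_
    exact (continuous_eval_const _).comp
      ((primitive (G.len e)).continuous.comp (PiLp.continuous_apply 2 _ e))
  let C₀ : G.EdgeL2 →L[ℂ] (V → ℂ) := B.toContinuousLinearMap ∘L ⟨ends, hends⟩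
  have hC₀ (g : G.EdgeL2) : G.IsCompat (C₀ g) g := fun e => hB _ e
  let A₀ : G.EdgeL2 →L[ℂ] G.EdgeL2 := G.graphL2 ∘L C₀.prod (ContinuousLinearMap.id ℂ _)
  -- Minus the mean of the primitive `A₀ g`; adding it to the vertex values makes the primitive
  -- orthogonal to `1`.
  let c : G.EdgeL2 →L[ℂ] ℂ := -(inner ℂ G.oneL2 G.oneL2)⁻¹ • (innerSL ℂ G.oneL2 ∘L A₀)
  refine ⟨C₀ + c.smulRight (1 : V → ℂ), fun g e => ?_, fun g => ?_⟩
  · rw [← hC₀ g e]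
    simp
  · change inner ℂ G.oneL2 (G.graphL2 (C₀ g + c g • 1, g)) = 0
    rw [graphL2_add_const, inner_add_right, inner_smul_right]
    change inner ℂ G.oneL2 (G.graphL2 (C₀ g, g)) +
      -(inner ℂ G.oneL2 G.oneL2)⁻¹ * inner ℂ G.oneL2 (G.graphL2 (C₀ g, g)) *
        inner ℂ G.oneL2 G.oneL2 = 0
    have := inner_oneL2_self_ne_zero (G := G)
    field_simp
    ring

/-- On each edge this is a rank-one operator plus the compact primitive; finitely many edges give a
product of compact sets. -/
theorem isCompactOperator_graphL2_comp [Finite V] (C : G.EdgeL2 →L[ℂ] (V → ℂ)) :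
    IsCompactOperator (G.graphL2 ∘L C.prod (ContinuousLinearMap.id ℂ _)) := by
  have hconst (e : E) : IsCompactOperator (ContinuousLinearMap.smulRight
      (ContinuousLinearMap.id ℂ ℂ) (1 : C(Set.Icc (0 : ℝ) (G.len e), ℂ))) :=
    isCompactOperator_of_locallyCompactSpace_rng _
  have hedge (e : E) : IsCompactOperator fun g : G.EdgeL2 =>
      ofContinuous (G.len_pos e).le (G.edgeFun e (C g, g)) := by
    have h1 := (hconst e).comp_clm
      ((ContinuousLinearMap.proj (R := ℂ) (φ := fun _ : V => ℂ) (G.src e)) ∘L C)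
    have h2 := (isCompactOperator_primitive (G.len e)).comp_clm
      (PiLp.proj (𝕜 := ℂ) 2 (fun e : E => IntervalL2 (G.len e)) e)
    exact (h1.add h2).clm_comp (ofContinuous (G.len_pos e).le)
  choose K hK hK' using hedge
  refine ⟨WithLp.toLp 2 '' Set.univ.pi K, (isCompact_univ_pi hK).image
    (PiLp.continuous_toLp 2 _), ?_⟩
  refine Filter.mem_of_superset (Filter.iInter_mem.2 hK') fun g hg => ?_
  rw [Set.mem_iInter] at hg
  exact ⟨_, fun e _ => hg e, rfl⟩

end MetricGraph

/-! ### Orthogonality of sines and cosines -/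

theorem intervalIntegral_norm_sq_sum {ι : Type*} [Fintype ι] {f : ι → ℝ → ℝ} {D : ℝ}
    (hf : ∀ i, Continuous (f i)) (horth : ∀ i j, i ≠ j → ∫ t in (0 : ℝ)..D, f i t * f j t = 0)
    (a : ι → ℂ) :
    ∫ t in (0 : ℝ)..D, ‖∑ i, a i * f i t‖ ^ 2 = ∑ i, ‖a i‖ ^ 2 * ∫ t in (0 : ℝ)..D, f i t ^ 2 := by
  have h (t : ℝ) : ‖∑ i, a i * f i t‖ ^ 2 =
      ∑ i, ∑ j, (a i * starRingEnd ℂ (a j)).re * (f i t * f j t) := by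
    rw [← Complex.ofReal_re (‖∑ i, a i * f i t‖ ^ 2), Complex.ofReal_pow, ← Complex.mul_conj',
      map_sum, Finset.sum_mul_sum, Complex.re_sum]
    refine Finset.sum_congr rfl fun i _ => ?_
    rw [Complex.re_sum]
    refine Finset.sum_congr rfl fun j _ => ?_
    rw [← Complex.re_mul_ofReal]
    congr 1
    simp only [map_mul, Complex.conj_ofReal]
    push_cast
    ring
  have hint (i j : ι) : IntervalIntegrable
      (fun t => (a i * starRingEnd ℂ (a j)).re * (f i t * f j t)) volume 0 D :=
    (continuous_const.mul ((hf i).mul (hf j))).intervalIntegrable _ _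
  simp only [h]
  have hint' (i : ι) : IntervalIntegrable
      (fun t => ∑ j, (a i * starRingEnd ℂ (a j)).re * (f i t * f j t)) volume 0 D :=
    (continuous_finsetSum _ fun j _ =>
      continuous_const.mul ((hf i).mul (hf j))).intervalIntegrable _ _
  rw [intervalIntegral.integral_finsetSum fun i _ => hint' i]
  refine Finset.sum_congr rfl fun i _ => ?_
  rw [intervalIntegral.integral_finsetSum fun j _ => hint i j, Finset.sum_eq_single i]
  · rw [intervalIntegral.integral_const_mul, Complex.mul_conj, Complex.ofReal_re,
      Complex.normSq_eq_norm_sq]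
    simp only [sq]
  · intro j _ hj
    rw [intervalIntegral.integral_const_mul, horth i j hj.symm, mul_zero]
  · simp

section Trigonometric

variable {D : ℝ}

/-- The frequency is an integer because the product-to-sum formulas produce `m - n`. -/
theorem integral_cos_int_mul_pi_div (hD : D ≠ 0) {n : ℤ} (hn : n ≠ 0) :
    ∫ t in (0 : ℝ)..D, Real.cos (n * Real.pi / D * t) = 0 := by
  have hn' : (n : ℝ) ≠ 0 := by exact_mod_cast hn
  have h : (n : ℝ) * Real.pi / D ≠ 0 := by positivity
  rw [intervalIntegral.integral_comp_mul_left (fun x => Real.cos x) h, integral_cos]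
  simp [div_mul_cancel₀ _ hD, Real.sin_int_mul_pi]

theorem integral_cos_mul_cos (hD : D ≠ 0) {m n : ℕ} (h : m ≠ n) :
    ∫ t in (0 : ℝ)..D, Real.cos (m * Real.pi / D * t) * Real.cos (n * Real.pi / D * t) = 0 := by
  have h1 := integral_cos_int_mul_pi_div hD (n := (m : ℤ) - n) (by omega)
  have h2 := integral_cos_int_mul_pi_div hD (n := (m : ℤ) + n) (by omega)
  have h3 (t : ℝ) : Real.cos (m * Real.pi / D * t) * Real.cos (n * Real.pi / D * t) =
      (Real.cos (((m : ℤ) - n : ℤ) * Real.pi / D * t) +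
        Real.cos (((m : ℤ) + n : ℤ) * Real.pi / D * t)) / 2 := by
    have e1 : (((m : ℤ) - n : ℤ) : ℝ) * Real.pi / D * t =
      m * Real.pi / D * t - n * Real.pi / D * t := by push_cast; ring
    have e2 : (((m : ℤ) + n : ℤ) : ℝ) * Real.pi / D * t =
      m * Real.pi / D * t + n * Real.pi / D * t := by push_cast; ring
    rw [e1, e2, Real.cos_add, Real.cos_sub]
    ring
  simp only [h3]
  rw [intervalIntegral.integral_div, intervalIntegral.integral_add, h1, h2]
  · simp
  all_goals exact Continuous.intervalIntegrable (by fun_prop) _ _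

theorem integral_sin_mul_sin (hD : D ≠ 0) {m n : ℕ} (h : m ≠ n) :
    ∫ t in (0 : ℝ)..D, Real.sin (m * Real.pi / D * t) * Real.sin (n * Real.pi / D * t) = 0 := by
  have h1 := integral_cos_int_mul_pi_div hD (n := (m : ℤ) - n) (by omega)
  have h2 := integral_cos_int_mul_pi_div hD (n := (m : ℤ) + n) (by omega)
  have h3 (t : ℝ) : Real.sin (m * Real.pi / D * t) * Real.sin (n * Real.pi / D * t) =
      (Real.cos (((m : ℤ) - n : ℤ) * Real.pi / D * t) -
        Real.cos (((m : ℤ) + n : ℤ) * Real.pi / D * t)) / 2 := by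
    have e1 : (((m : ℤ) - n : ℤ) : ℝ) * Real.pi / D * t =
      m * Real.pi / D * t - n * Real.pi / D * t := by push_cast; ring
    have e2 : (((m : ℤ) + n : ℤ) : ℝ) * Real.pi / D * t =
      m * Real.pi / D * t + n * Real.pi / D * t := by push_cast; ring
    rw [e1, e2, Real.cos_add, Real.cos_sub]
    ring
  simp only [h3]
  rw [intervalIntegral.integral_div, intervalIntegral.integral_sub, h1, h2]
  · simp
  all_goals exact Continuous.intervalIntegrable (by fun_prop) _ _

theorem integral_cos_sq_pi_div (hD : D ≠ 0) {n : ℕ} (hn : n ≠ 0) :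
    ∫ t in (0 : ℝ)..D, Real.cos (n * Real.pi / D * t) ^ 2 = D / 2 := by
  have h1 := integral_cos_int_mul_pi_div hD (n := 2 * n) (by omega)
  have h3 (t : ℝ) : Real.cos (n * Real.pi / D * t) ^ 2 =
      1 / 2 + Real.cos ((2 * n : ℤ) * Real.pi / D * t) / 2 := by
    rw [Real.cos_sq]
    push_cast
    ring_nf
  simp only [h3]
  rw [intervalIntegral.integral_add, intervalIntegral.integral_div _
    (fun t => Real.cos ((2 * n : ℤ) * Real.pi / D * t)), h1]
  · simp
    ring
  all_goals exact Continuous.intervalIntegrable (by fun_prop) _ _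

theorem integral_sin_sq_pi_div (hD : D ≠ 0) {n : ℕ} (hn : n ≠ 0) :
    ∫ t in (0 : ℝ)..D, Real.sin (n * Real.pi / D * t) ^ 2 = D / 2 := by
  simp only [Real.sin_sq]
  rw [intervalIntegral.integral_sub, integral_cos_sq_pi_div hD hn]
  · simp
    ring
  all_goals exact Continuous.intervalIntegrable (by fun_prop) _ _

/-- The trigonometric polynomial `∑ j, a j cos (j π t / D)`, where `j = 1, …, k`. -/
noncomputable def cosPoly (D : ℝ) {k : ℕ} (a : Fin k → ℂ) (t : ℝ) : ℂ :=
  ∑ i, a i * Real.cos ((i + 1 : ℕ) * Real.pi / D * t)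

/-- The derivative of `cosPoly`, as a linear function of the coefficients. -/
noncomputable def derivCosPoly (D : ℝ) (k : ℕ) : (Fin k → ℂ) →ₗ[ℂ] C(ℝ, ℂ) where
  toFun a := ⟨fun t => ∑ i : Fin k, -(((i + 1 : ℕ) * Real.pi / D : ℝ) : ℂ) * a i *
    Real.sin ((i + 1 : ℕ) * Real.pi / D * t), by fun_prop⟩
  map_add' a b := by
    ext t
    simp [mul_add, add_mul, Finset.sum_add_distrib]
  map_smul' c a := by
    ext t
    simp only [ContinuousMap.coe_mk, Pi.smul_apply, smul_eq_mul, RingHom.id_apply,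
      ContinuousMap.smul_apply, Finset.mul_sum]
    refine Finset.sum_congr rfl fun i _ => ?_
    ring

theorem hasDerivAt_cosPoly {k : ℕ} (a : Fin k → ℂ) (t : ℝ) :
    HasDerivAt (cosPoly D a) (derivCosPoly D k a t) t := by
  suffices h : ∀ i ∈ Finset.univ, HasDerivAt
      (fun t : ℝ => a i * (Real.cos ((i + 1 : ℕ) * Real.pi / D * t) : ℂ))
      (-(((i + 1 : ℕ) * Real.pi / D : ℝ) : ℂ) * a i * Real.sin ((i + 1 : ℕ) * Real.pi / D * t)) t
    from HasDerivAt.fun_sum h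
  intro i _
  have h1 : HasDerivAt (fun t : ℝ => (i + 1 : ℕ) * Real.pi / D * t)
      ((i + 1 : ℕ) * Real.pi / D) t := by
    simpa using (hasDerivAt_id t).const_mul (((i + 1 : ℕ) : ℝ) * Real.pi / D)
  have h2 := (h1.cos.ofReal_comp).const_mul (a i)
  refine h2.congr_deriv ?_
  push_cast
  ring

theorem integral_norm_derivCosPoly_sq (hD : D ≠ 0) {k : ℕ} (a : Fin k → ℂ) :
    ∫ t in (0 : ℝ)..D, ‖derivCosPoly D k a t‖ ^ 2 =
      ∑ i : Fin k, ((i + 1 : ℕ) * Real.pi / D) ^ 2 * ‖a i‖ ^ 2 * (D / 2) := by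
  have h := intervalIntegral_norm_sq_sum (D := D)
    (f := fun (i : Fin k) t => Real.sin ((i + 1 : ℕ) * Real.pi / D * t)) (fun i => by fun_prop)
    (fun i j hij => integral_sin_mul_sin hD (by simpa [Fin.ext_iff] using hij))
    (fun i => -(((i + 1 : ℕ) * Real.pi / D : ℝ) : ℂ) * a i)
  refine h.trans (Finset.sum_congr rfl fun i _ => ?_)
  rw [integral_sin_sq_pi_div hD (Nat.succ_ne_zero i), norm_mul, norm_neg, Complex.norm_real,
    mul_pow, Real.norm_eq_abs, sq_abs]

theorem integral_norm_cosPoly_add_const_sq (hD : D ≠ 0) {k : ℕ} (a : Fin k → ℂ) (c : ℂ) :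
    ∫ t in (0 : ℝ)..D, ‖cosPoly D a t + c‖ ^ 2 =
      ‖c‖ ^ 2 * D + ∑ i : Fin k, ‖a i‖ ^ 2 * (D / 2) := by
  have h := intervalIntegral_norm_sq_sum (D := D)
    -- The constant `c` is treated as the coefficient of the cosine of frequency zero.
    (f := fun (i : Fin (k + 1)) t => Real.cos ((i : ℕ) * Real.pi / D * t)) (fun i => by fun_prop)
    (fun i j hij => integral_cos_mul_cos hD (by simpa [Fin.ext_iff] using hij)) (Fin.cons c a)
  simp only [Fin.sum_univ_succ, Fin.cons_zero, Fin.cons_succ, Fin.val_succ] at h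
  rw [Finset.sum_congr rfl fun i _ => by rw [integral_cos_sq_pi_div hD (Nat.succ_ne_zero i)]] at h
  refine Eq.trans (intervalIntegral.integral_congr fun t _ => ?_) (h.trans ?_)
  · simp [cosPoly, add_comm]
  · simp

/-- Both integrals are diagonal in the coefficients, and the frequencies are at most `kπ/D`. The
constant is orthogonal to the cosines and only helps; it is left free because a primitive along the
path is known only up to a constant. -/
theorem integral_norm_derivCosPoly_sq_le (hD : 0 < D) {k : ℕ} (a : Fin k → ℂ) (c : ℂ) :
    ∫ t in (0 : ℝ)..D, ‖derivCosPoly D k a t‖ ^ 2 ≤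
      (k * Real.pi / D) ^ 2 * ∫ t in (0 : ℝ)..D, ‖cosPoly D a t + c‖ ^ 2 := by
  rw [integral_norm_derivCosPoly_sq hD.ne', integral_norm_cosPoly_add_const_sq hD.ne', mul_add,
    Finset.mul_sum]
  refine le_add_of_nonneg_of_le (by positivity) (Finset.sum_le_sum fun i _ => ?_)
  rw [mul_assoc]
  have : ((i + 1 : ℕ) : ℝ) ≤ k := by exact_mod_cast i.2
  have := Real.pi_pos
  gcongr

end Trigonometric

/-! ### Trial functions along a trail, and the eigenvalue count -/

namespace MetricGraph

open IntervalL2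

variable {V E : Type*} {G : MetricGraph V E} [Fintype E]

open Classical in
/-- The `L²` function on `G` that is `σ e * ψ (β e + σ e * x)` on the edges `e ∈ S`, and zero on the
other edges. -/
noncomputable def unfoldPullback (G : MetricGraph V E) (S : Finset E) (σ β : E → ℝ) :
    C(ℝ, ℂ) →ₗ[ℂ] G.EdgeL2 where
  toFun ψ := WithLp.toLp 2 fun e => if e ∈ S then ofContinuous (G.len_pos e).le
    ⟨fun x => σ e * ψ (β e + σ e * x), by fun_prop⟩ else 0
  map_add' ψ χ := by
    ext1 e
    by_cases h : e ∈ S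
    · simp only [h, if_true, PiLp.add_apply, ← map_add]
      congr 1
      ext x
      simp [mul_add]
    · simp [h]
  map_smul' c ψ := by
    ext1 e
    by_cases h : e ∈ S
    · simp only [h, if_true, PiLp.smul_apply, ← map_smul, RingHom.id_apply]
      congr 1
      ext x
      simp
      ring
    · simp [h]

theorem unfoldPullback_of_mem {S : Finset E} {σ β : E → ℝ} (ψ : C(ℝ, ℂ)) {e : E} (h : e ∈ S) :
    G.unfoldPullback S σ β ψ e = ofContinuous (G.len_pos e).le
      ⟨fun x => σ e * ψ (β e + σ e * x), by fun_prop⟩ := if_pos h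

theorem unfoldPullback_of_notMem {S : Finset E} {σ β : E → ℝ} (ψ : C(ℝ, ℂ)) {e : E} (h : e ∉ S) :
    G.unfoldPullback S σ β ψ e = 0 := if_neg h

theorem norm_unfoldPullback_sq {S : Finset E} {σ β : E → ℝ} (hσ : ∀ e ∈ S, σ e = 1 ∨ σ e = -1)
    (ψ : C(ℝ, ℂ)) : ‖G.unfoldPullback S σ β ψ‖ ^ 2 =
      ∑ e ∈ S, ∫ x in (0 : ℝ)..G.len e, ‖ψ (β e + σ e * x)‖ ^ 2 := by
  rw [PiLp.norm_sq_eq_of_L2, ← Finset.sum_subset (Finset.subset_univ S)]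
  · refine Finset.sum_congr rfl fun e he => ?_
    rw [unfoldPullback_of_mem ψ he, norm_ofContinuous_sq]
    refine intervalIntegral.integral_congr fun x hx => ?_
    rw [Set.uIcc_of_le (G.len_pos e).le] at hx
    simp only [Set.IccExtend_of_mem _ _ hx, ContinuousMap.coe_mk, norm_mul, Complex.norm_real]
    rcases hσ e he with h | h <;> simp [h]
  · intro e _ he
    simp [unfoldPullback_of_notMem ψ he]

/-- The factor `σ e` in `unfoldPullback` is the inner derivative of the chain rule. -/
theorem primitive_unfoldPullback {S : Finset E} {σ β : E → ℝ} {ψ : C(ℝ, ℂ)} {φ : ℝ → ℂ}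
    (hφ : ∀ t, HasDerivAt φ (ψ t) t) {e : E} (h : e ∈ S) (x : Set.Icc (0 : ℝ) (G.len e)) :
    primitive (G.len e) (G.unfoldPullback S σ β ψ e) x = φ (β e + σ e * x) - φ (β e) := by
  rw [unfoldPullback_of_mem ψ h, primitive_ofContinuous]
  have hd (t : ℝ) : HasDerivAt (fun t => φ (β e + σ e * t)) (σ e * ψ (β e + σ e * t)) t := by
    have h1 : HasDerivAt (fun t => β e + σ e * t) (σ e) t := by
      simpa using ((hasDerivAt_id t).const_mul (σ e)).const_add (β e)
    exact ((hφ _).scomp t h1).congr_deriv (by simp)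
  have hc : Continuous fun t => (σ e : ℂ) * ψ (β e + σ e * t) := by fun_prop
  have hint := intervalIntegral.integral_eq_sub_of_hasDerivAt (fun t _ => hd t)
    (hc.intervalIntegrable 0 x)
  rw [mul_zero, add_zero] at hint
  rw [← hint]
  refine intervalIntegral.integral_congr fun t ht => ?_
  rw [Set.uIcc_of_le x.2.1] at ht
  exact Set.IccExtend_of_mem _ _ ⟨ht.1, ht.2.trans x.2.2⟩

theorem graphFun_const_smul_one (c : ℂ) : G.graphFun (c • 1, 0) = fun _ => c := by
  funext p
  refine (edgeFun_apply p.1 (c • 1) 0 p.2).trans ?_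
  simp

theorem const_mem_spectralSpace [DecidableEq V] {μ : ℝ} (hμ : 0 ≤ μ) (c : ℂ) :
    (fun _ => c) ∈ G.spectralSpace μ := by
  refine Submodule.subset_span ⟨0, hμ, ?_⟩
  refine ⟨fun _ _ => 0, fun e => ⟨MemLp.zero, fun x _ => ?_⟩, fun e => ⟨?_, fun x _ => ?_⟩,
    fun _ _ _ _ _ => rfl, fun v => by simp⟩
  · simp [onEdge, Set.IccExtend]
  · simp only [Complex.ofReal_zero, zero_mul, neg_zero]
    exact MemLp.zero
  · simp

/-- The pairing with a function orthogonal to the constants depends only on the derivative. -/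
theorem IsTree.inner_graphL2_eq (hG : G.IsTree) {φ ψ : V → ℂ} {h q : G.EdgeL2}
    (hφ : G.IsCompat φ h) (hψ : G.IsCompat ψ h) (hq : inner ℂ G.oneL2 q = 0) :
    inner ℂ (G.graphL2 (φ, h)) q = inner ℂ (G.graphL2 (ψ, h)) q := by
  obtain ⟨v⟩ := hG.2.2.connected.nonempty
  have hconst : φ = ψ + (φ v - ψ v) • 1 := by
    funext u
    have := hG.eq_of_src_eq_tgt (a := φ - ψ) (fun e => by
      have h1 := hφ e
      have h2 := hψ e
      simp only [Pi.sub_apply]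
      linear_combination h1 - h2) u v
    simp only [Pi.sub_apply] at this
    simp [← this]
  rw [hconst, graphL2_add_const, inner_add_left, inner_smul_left, hq, mul_zero, add_zero]

/-- Pairing the eigenvalue equation of A†A with any `h` gives the weak equation for the test
functions `A h`. An arbitrary test function with derivative `h` differs from `A h` by a constant,
which is orthogonal to `A g`. -/
theorem IsTree.graphFun_mem_spectralSpace [DecidableEq V] (hG : G.IsTree)
    {C : G.EdgeL2 →L[ℂ] (V → ℂ)} (hC : ∀ g, G.IsCompat (C g) g)
    (hC1 : ∀ g, inner ℂ G.oneL2 (G.graphL2 (C g, g)) = 0) {μ t : ℝ} (hμ : 0 < μ) (ht : μ⁻¹ ≤ t)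
    {g : G.EdgeL2} (hg : (ContinuousLinearMap.adjoint
      (G.graphL2 ∘L C.prod (ContinuousLinearMap.id ℂ _)) ∘L
        (G.graphL2 ∘L C.prod (ContinuousLinearMap.id ℂ _))) g = (t : ℂ) • g) :
    G.graphFun (C g, g) ∈ G.spectralSpace μ := by
  have ht0 : 0 < t := (inv_pos.2 hμ).trans_le ht
  refine Submodule.subset_span ⟨t⁻¹, inv_le_of_inv_le₀ hμ ht,
    (hC g).isLaplacian ht0.ne' fun φ h hφ => ?_⟩
  rw [hG.inner_graphL2_eq hφ (hC h) (hC1 g), ← inner_smul_right, ← hg]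
  exact (ContinuousLinearMap.adjoint_inner_right
    (G.graphL2 ∘L C.prod (ContinuousLinearMap.id ℂ _)) h _).symm

/-- The eigenvalues of the Laplacian can be counted from below by means of trial functions, given
by their derivatives. -/
theorem IsTree.le_rank_spectralSpace [Fintype V] [DecidableEq V] [Nonempty E] (hG : G.IsTree)
    {k : ℕ} (g : (Fin k → ℂ) →ₗ[ℂ] G.EdgeL2) (hg : Function.Injective g) {κ μ : ℝ} (hμ : 0 < μ)
    (hκ : κ < μ)
    (h : ∀ a c, G.IsCompat c (g a) → ‖g a‖ ^ 2 ≤ κ * ‖G.graphL2 (c, g a)‖ ^ 2) :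
    ((k + 1 : ℕ) : Cardinal) ≤ Module.rank ℂ (G.spectralSpace μ) := by
  obtain ⟨C, hC, hC1⟩ := hG.exists_primitive
  set A : G.EdgeL2 →L[ℂ] G.EdgeL2 := G.graphL2 ∘L C.prod (ContinuousLinearMap.id ℂ _)
  have hA (g : G.EdgeL2) : A g = G.graphL2 (C g, g) := rfl
  have hrank := ContinuousLinearMap.le_rank_iSup_eigenspace_adjoint_comp
    (isCompactOperator_graphL2_comp C) g hg hμ hκ fun a => h a _ (hC _)
  set M : Submodule ℂ G.EdgeL2 := ⨆ t : {t : ℝ // μ⁻¹ ≤ t}, Module.End.eigenspace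
    ((ContinuousLinearMap.adjoint A ∘L A : G.EdgeL2 →L[ℂ] G.EdgeL2) : Module.End ℂ G.EdgeL2)
    (t : ℂ)
  let Ψ : ℂ × G.EdgeL2 →ₗ[ℂ] (G.EdgePoint → ℂ) := G.graphFun ∘ₗ
    LinearMap.prod (C.toLinearMap ∘ₗ LinearMap.snd ℂ _ _ +
      (LinearMap.fst ℂ ℂ G.EdgeL2).smulRight (1 : V → ℂ)) (LinearMap.snd ℂ _ _)
  have hΨ (c : ℂ) (g : G.EdgeL2) : Ψ (c, g) = G.graphFun (C g + c • 1, g) := rfl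
  -- Pairing with `1` kills the mean-zero part and gives `c = 0`; then all primitives vanish, hence
  -- `g = 0`. So the constants are independent of the eigenfunctions from `M` and supply the `+ 1`.
  have hΨinj : Function.Injective Ψ := by
    refine (injective_iff_map_eq_zero _).2 ?_
    rintro ⟨c, g⟩ h0
    rw [hΨ] at h0
    have hedge (e : E) : G.edgeFun e (C g + c • 1, g) = 0 := by
      ext x
      exact congrFun h0 ⟨e, x⟩
    have hL2 : G.graphL2 (C g + c • 1, g) = 0 := by
      ext1 e
      rw [graphL2_apply, hedge, map_zero]
      rfl
    have hc := congrArg (inner ℂ G.oneL2) hL2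
    rw [graphL2_add_const, inner_add_right, hC1, inner_smul_right, zero_add, inner_zero_right,
      mul_eq_zero, or_iff_left inner_oneL2_self_ne_zero] at hc
    have hg0 : g = 0 := by
      ext1 e
      refine primitive_injective (G.len e) ?_
      ext x
      have h1 := DFunLike.congr_fun (hedge e) x
      have h2 := DFunLike.congr_fun (hedge e) ⟨0, le_rfl, (G.len_pos e).le⟩
      rw [edgeFun_apply] at h1 h2
      rw [primitive_apply (g e), intervalIntegral.integral_same, add_zero] at h2
      rw [h2] at h1
      simpa using h1
    rw [hc, hg0]
    rfl
  have hΨmem (x : ℂ × M) : Ψ (x.1, (x.2 : G.EdgeL2)) ∈ G.spectralSpace μ := by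
    obtain ⟨c, g, hgM⟩ := x
    have hsplit : Ψ (c, g) = (fun _ => c) + G.graphFun (C g, g) := by
      rw [hΨ, ← graphFun_const_smul_one c, ← map_add, Prod.mk_add_mk, zero_add, add_comm]
    change Ψ (c, g) ∈ _
    rw [hsplit]
    refine Submodule.add_mem _ (const_mem_spectralSpace hμ.le c) ?_
    have hle : M ≤ (G.spectralSpace μ).comap
        (G.graphFun ∘ₗ C.toLinearMap.prod LinearMap.id) := by
      refine iSup_le fun t g hg => ?_
      exact hG.graphFun_mem_spectralSpace hC hC1 hμ t.2 (Module.End.mem_eigenspace_iff.1 hg)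
    exact hle hgM
  let Θ : ℂ × M →ₗ[ℂ] G.spectralSpace μ :=
    (Ψ ∘ₗ (LinearMap.id.prodMap M.subtype)).codRestrict _ hΨmem
  have hΘ : Function.Injective Θ := by
    rintro ⟨c, g⟩ ⟨c', g'⟩ h0
    have h1 : ((c, (g : G.EdgeL2)) : ℂ × G.EdgeL2) = (c', (g' : G.EdgeL2)) :=
      hΨinj (congrArg Subtype.val h0)
    rw [Prod.mk.injEq, Subtype.coe_inj] at h1
    exact Prod.ext h1.1 h1.2
  have hprod : ((k + 1 : ℕ) : Cardinal) ≤ Module.rank ℂ (ℂ × M) := by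
    rw [rank_prod, CommSemiring.rank_self, Cardinal.lift_one, add_comm]
    push_cast
    refine add_le_add le_rfl ?_
    rwa [Cardinal.lift_uzero]
  exact hprod.trans (LinearMap.rank_le_of_injective Θ hΘ)

/-- The cosines along a trail of length `D` show that there are at least `k + 1` eigenvalues
`≤ μ`, for every `μ > (k π / D)²`. -/
theorem IsTree.le_rank_spectralSpace_of_isTrail [Fintype V] [DecidableEq V] [Nonempty E]
    (hG : G.IsTree) {u w : V} (p : G.toSimpleGraph.Walk u w) (hp : p.IsTrail)
    (hlen : 0 < walkLen p) (k : ℕ) {μ : ℝ} (hμ : (k * Real.pi / walkLen p) ^ 2 < μ) :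
    ((k + 1 : ℕ) : Cardinal) ≤ Module.rank ℂ (G.spectralSpace μ) := by
  obtain ⟨S, σ, β, -, hσ, hF, hpot⟩ := exists_unfolding hG p hp 0
  set D := walkLen p
  rw [zero_add] at hF
  let g : (Fin k → ℂ) →ₗ[ℂ] G.EdgeL2 := G.unfoldPullback S σ β ∘ₗ derivCosPoly D k
  have hnorm (a : Fin k → ℂ) :
      ‖g a‖ ^ 2 = ∫ t in (0 : ℝ)..D, ‖derivCosPoly D k a t‖ ^ 2 :=
    (norm_unfoldPullback_sq hσ _).trans
      (hF (fun t => ‖derivCosPoly D k a t‖ ^ 2) (by fun_prop))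
  refine hG.le_rank_spectralSpace g ?_ ((sq_nonneg _).trans_lt hμ) hμ fun a c hc => ?_
  -- All frequencies `i + 1` are nonzero, so the derivative determines the coefficients.
  · refine (injective_iff_map_eq_zero _).2 fun a ha => ?_
    have h := hnorm a
    rw [ha, norm_zero, integral_norm_derivCosPoly_sq hlen.ne', zero_pow two_ne_zero, eq_comm,
      Finset.sum_eq_zero_iff_of_nonneg fun i _ => by positivity] at h
    funext i
    have hi := h i (Finset.mem_univ i)
    have h1 : (((i + 1 : ℕ) : ℝ) * Real.pi / D) ^ 2 ≠ 0 := by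
      have := Real.pi_pos
      positivity
    simpa [h1, hlen.ne', Nat.cast_add_one_ne_zero] using hi
  · have hprim {e : E} (he : e ∈ S) := primitive_unfoldPullback (G := G) (σ := σ) (β := β)
      (hasDerivAt_cosPoly (D := D) a) he
    -- Along the trail the primitive with vertex values `c` is the cosine polynomial plus the single
    -- constant `c u - cosPoly D a 0`.
    have hpot' := hpot c (cosPoly D a) fun e he => (hc e).trans (hprim he _)
    have hcont : Continuous fun t => ‖cosPoly D a t + (c u - cosPoly D a 0)‖ ^ 2 := by
      have : Continuous (cosPoly D a) :=
        continuous_iff_continuousAt.2 fun t => (hasDerivAt_cosPoly a t).continuousAt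
      fun_prop
    rw [hnorm]
    refine (integral_norm_derivCosPoly_sq_le hlen a (c u - cosPoly D a 0)).trans ?_
    gcongr
    rw [← hF _ hcont, norm_graphL2_sq]
    -- The edges off the trail contribute nonnegative terms, which are dropped.
    refine le_trans (le_of_eq (Finset.sum_congr rfl fun e he => ?_))
      (Finset.sum_le_sum_of_subset_of_nonneg (Finset.subset_univ S) fun e _ _ =>
        intervalIntegral.integral_nonneg (G.len_pos e).le fun _ _ => by positivity)
    refine intervalIntegral.integral_congr fun x hx => ?_
    rw [Set.uIcc_of_le (G.len_pos e).le] at hx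
    simp only [Set.IccExtend_of_mem _ _ hx]
    rw [edgeFun_apply]
    have h1 := hprim he ⟨x, hx⟩
    have h2 := hpot' e he
    congr 2
    refine Eq.trans ?_ (congrArg (c (G.src e) + ·) h1).symm
    linear_combination -h2

end MetricGraph

theorem theorem3p4 {V E : Type*} [Fintype V] [DecidableEq V] [Fintype E] [Nonempty E]
    (G : MetricGraph V E) (hG : G.IsTree) (k : ℕ) :
    G.eigenvalue (k + 1) ≤ (((k : ℝ) ^ 2 * Real.pi ^ 2 / G.diam ^ 2 : ℝ) : EReal) := by
  have hd := MetricGraph.diam_pos hG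
  -- Each real `μ` above the bound leaves room for a path slightly shorter than the diameter; any
  -- length `D > √(k²π²/μ)` satisfies `(kπ/D)² < μ`.
  refine EReal.le_of_forall_lt_iff_le.1 fun μ hμ => ?_
  rw [EReal.coe_lt_coe_iff, div_lt_iff₀ (by positivity)] at hμ
  have hμ0 : 0 < μ := by
    by_contra h
    have : (0 : ℝ) ≤ (k : ℝ) ^ 2 * Real.pi ^ 2 := by positivity
    nlinarith [sq_nonneg G.diam]
  have hlt : √(((k : ℝ) ^ 2 * Real.pi ^ 2) / μ) < G.diam := by
    rw [Real.sqrt_lt' hd, div_lt_iff₀ hμ0]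
    linarith
  obtain ⟨u, w, p, hp, hlen⟩ := MetricGraph.exists_isPath_lt_walkLen hG hlt
  have hpos := (Real.sqrt_nonneg _).trans_lt hlen
  rw [Real.sqrt_lt' hpos, div_lt_iff₀ hμ0] at hlen
  refine sInf_le ⟨μ, rfl, hG.le_rank_spectralSpace_of_isTrail p hp.isTrail hpos k ?_⟩
  rw [div_pow, div_lt_iff₀ (by positivity), mul_pow]
  linarith
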